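/- Let $G=(V,E)$ be a finite simple graph and let $n=|V|$, $m=|E|$. To each vertex $v$ attach a random variable $a_v$, an arc $(v,w)$ with $w$ a neighbour of $v$. For every cycle of $G$ (of length at least $3$) fix an arbitrary one of its two orientations and call it wrong. For an assignment $\sigma=(a_v)_{v\in V}$, the bad event $B_e$ ($e\in E$) occurs if both orientations of $e$ appear in $\sigma$, and the bad event $B_C$ ($C$ a cycle of $G$) occurs if $C$ appears in $\sigma$ in its wrong orientation. Write $\mathrm{var}(B_e)$ for the variables at the two endpoints of $e$ and $\mathrm{var}(B_C)$ for the variables at the vertices of $C$. Bicycle popping draws all $a_v$ independently, each uniform over the neighbours of $v$; then, as long as some bad event occurs, it simultaneously re-draws, independently and uniformly, all variables $a_v$ with $v$ on an edge or cycle whose bad event occurs. Let $T$ be the total number of variables resampled (counted with multiplicity, the initial draw not included). Let $\Omega_0$ be the set of assignments in which no bad event occurs, and let $\Omega_E^{\mathrm{var}}$ (respectively $\Omega_{\mathrm{cycle}}^{\mathrm{var}}$) be the set of pairs $(\sigma,a_v)$ such that exactly one bad event $B$ occurs in $\sigma$, $B$ is of the form $B_e$ (respectively $B_C$), and $a_v\in\mathrm{var}(B)$.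 Suppose that $G$ is connected and $m\ge n$. Then, for every choice of the wrong orientations, $$\mathbb{E}\,T\le 2n^2-n .$$ Moreover $|\Omega_0|>0$, $$\mathbb{E}\,T=\frac{|\Omega_E^{\mathrm{var}}|}{|\Omega_0|}+\frac{|\Omega_{\mathrm{cycle}}^{\mathrm{var}}|}{|\Omega_0|},\qquad |\Omega_E^{\mathrm{var}}|\le 2n(n-1)\,|\Omega_0|,\qquad |\Omega_{\mathrm{cycle}}^{\mathrm{var}}|\le n\,|\Omega_0| .$$ The bound is tight: if $G$ is a cycle of length $n\ge 3$, then $\mathbb{E}\,T=2n^2-n$. -/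

import Mathlib

open MeasureTheory
open scoped ENNReal

noncomputable section

namespace BicyclePopping

/-- The possible values of the arc variable `a_v`: the neighbours `w` of `v`, the arc being
`(v, w)`. -/
def Arc {V : Type*} (G : SimpleGraph V) (v : V) : Type _ := {w : V // G.Adj v w}

/-- The end vertex `w` of the arc `a_v = (v, w)`. -/
def Arc.head {V : Type*} {G : SimpleGraph V} {v : V} (a : Arc G v) : V := a.1

instance {V : Type*} (G : SimpleGraph V) (v : V) : MeasurableSpace (Arc G v) := ⊤

instance {V : Type*} (G : SimpleGraph V) (v : V) : DiscreteMeasurableSpace (Arc G v) :=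
  ⟨fun _ => trivial⟩

instance {V : Type*} [Finite V] (G : SimpleGraph V) (v : V) : Finite (Arc G v) :=
  inferInstanceAs (Finite {w : V // G.Adj v w})

/-- An assignment `σ = (a_v)_{v ∈ V}` of an arc to every vertex. -/
abbrev Assignment {V : Type*} (G : SimpleGraph V) : Type _ := (v : V) → Arc G v

/-- An oriented cycle (of length at least three) of `G`, encoded as the cyclic permutation that
sends each vertex of the cycle to the next one and fixes all vertices off the cycle. The same
cycle with the opposite orientation is `c⁻¹`. -/
structure IsOrientedCycle {V : Type*} (G : SimpleGraph V) (c : Equiv.Perm V) : Prop where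
  isCycle : c.IsCycle
  three_le : 3 ≤ {v : V | c v ≠ v}.ncard
  adj : ∀ v, c v ≠ v → G.Adj v (c v)

/-- A choice, for each cycle of `G`, of exactly one of its two orientations: the one
declared wrong (bad). -/
structure CycleOrientation {V : Type*} (G : SimpleGraph V) where
  wrong : Set (Equiv.Perm V)
  isOrientedCycle : ∀ c ∈ wrong, IsOrientedCycle G c
  mem_iff : ∀ c, IsOrientedCycle G c → (c ∈ wrong ↔ c⁻¹ ∉ wrong)

section Events

variable {V : Type*} {G : SimpleGraph V} (O : CycleOrientation G)

/-- The event `B_e`: both orientations of the edge `e` appear in `σ`. -/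
def edgeEvent (e : G.edgeSet) : Set (Assignment G) :=
  {σ | ∀ u v : V, s(u, v) = (e : Sym2 V) → (σ u).head = v}

/-- The event that the oriented cycle `c` appears in `σ`. -/
def cycleEvent (G : SimpleGraph V) (c : Equiv.Perm V) : Set (Assignment G) :=
  {σ | ∀ v : V, c v ≠ v → (σ v).head = c v}

/-- The bad events, indexed by the edges and the cycles of `G`
(a cycle being given in its wrong orientation). -/
def badEvent : G.edgeSet ⊕ O.wrong → Set (Assignment G)
  | .inl e => edgeEvent e
  | .inr c => cycleEvent G c

/-- `var(B)`: the (indices of the) variables on which the bad event `B` depends. -/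
def badVars : G.edgeSet ⊕ O.wrong → Set V
  | .inl e => {v | v ∈ (e : Sym2 V)}
  | .inr c => {v | (c : Equiv.Perm V) v ≠ v}

/-- `Bad`: the vertices that lie on some edge or cycle whose bad event occurs in `σ`. -/
def Bad (σ : Assignment G) : Set V :=
  {v | ∃ i, σ ∈ badEvent O i ∧ v ∈ badVars O i}

/-- `Ω₀`: the assignments in which no bad event occurs. -/
def noBad : Set (Assignment G) := {σ | ∀ i, σ ∉ badEvent O i}

/-- `Ω_e` and `Ω_C`: the assignments in which exactly the bad event with index `i` occurs. -/
def onlyBad (i : G.edgeSet ⊕ O.wrong) : Set (Assignment G) :=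
  {σ | σ ∈ badEvent O i ∧ ∀ j, j ≠ i → σ ∉ badEvent O j}

/-- `Ω_E^var`. -/
def edgeVarPairs : Set (Assignment G × V) :=
  {p | ∃ e : G.edgeSet, p.1 ∈ onlyBad O (.inl e) ∧ p.2 ∈ badVars O (.inl e)}

/-- `Ω_cycle^var`. -/
def cycleVarPairs : Set (Assignment G × V) :=
  {p | ∃ c : O.wrong, p.1 ∈ onlyBad O (.inr c) ∧ p.2 ∈ badVars O (.inr c)}

open Classical in
/-- One iteration of the loop: re-randomize the variables in `Bad` using fresh values. -/
def resample (σ fresh : Assignment G) : Assignment G :=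
  fun v => if v ∈ Bad O σ then fresh v else σ v

/-- The assignment after `t` iterations, when the random values drawn are `ω 0, ω 1, …`.
Once no bad event is present, `Bad` is empty and the assignment no longer changes. -/
def run (ω : ℕ → Assignment G) : ℕ → Assignment G
  | 0 => ω 0
  | t + 1 => resample O (run ω t) (ω (t + 1))

/-- The total number of variables that are resampled in the course of the algorithm
(possibly `∞`, if it does not terminate). -/
def numResampled (ω : ℕ → Assignment G) : ℝ≥0∞ :=
  ∑' t : ℕ, ((Bad O (run O ω t)).ncard : ℝ≥0∞)

end Events

/-- The law of a random assignment: independent arcs, `a_v` uniform over the neighbours of `v`. -/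
def assignmentLaw {V : Type*} [Fintype V] (G : SimpleGraph V) : Measure (Assignment G) :=
  Measure.pi fun v => ProbabilityTheory.uniformOn (Set.univ : Set (Arc G v))

/-- The law of the random source of the algorithm: independent random assignments. -/
def sourceLaw {V : Type*} [Fintype V] (G : SimpleGraph V) : Measure (ℕ → Assignment G) :=
  Measure.infinitePi fun _ : ℕ => assignmentLaw G

/-- The expected number of variables resampled by bicycle popping on `G`. -/
def expectedResampled {V : Type*} [Fintype V] {G : SimpleGraph V} (O : CycleOrientation G) :
    ℝ≥0∞ :=
  ∫⁻ ω, numResampled O ω ∂(sourceLaw G)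

end BicyclePopping

end

/-!
The bad events of bicycle popping are *extremal*: regard a bidirected edge as a cycle of length two
of the map `v ↦ head of a_v`; then two bad events that occur together and share a vertex are both
the cycle of this map through the vertex, hence equal. The rest of the argument has two parts.

**The formula for the expectation.** For a set `W` of variables let `Ω_W` (`ExtremalEvents.avoid`)
be the set of assignments in which no event disjoint from `W` occurs. If the assignment is uniform
on `Ω_W` then, conditionally on its bad set being `W'`, the assignment after one round of resampling
is uniform on `Ω_{W'}` (`ExtremalEvents.mean_step`). So the bad sets form a Markov chain, started
from the set of all variables. Let `r(W)` be the sum of `|var(B)|` over the assignments in which `B`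
is the only event off `W` that occurs, divided by `|Ω_W|`. Splitting off one occurring event from
the bad set gives the identity `E[|Bad|] + r(W) = E[r(Bad)]` for a uniform element of `Ω_W`
(`ExtremalEvents.mean_ncard_bad`), that is, `h(W) = r(∅) - r(W)` satisfies the recursion for the
expected number of variables resampled from `Ω_W` on. Since `h` vanishes at `∅` and is bounded, the
expectation of `h` tends to zero along the run, and the total is `h(V) = r(∅)`
(`ExtremalEvents.hasSum_mean_iterate_step`), which is the asserted quotient.

**The bounds.** Reversing the only wrong cycle of an assignment gives an assignment without bad
events, from which together with any vertex of the cycle the original one is recovered; this is the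
bound `n`. If an assignment has a bidirected edge, the component of this edge is a tree. Because
`m ≥ n`, some unused edge `xy` starts at a vertex `x` of the tree. Reroot the tree at `x`, that is,
reverse the path from `x` to the bidirected edge, and let `x` point to `y` (`IsRerooting`). If `y`
is in the tree this closes a cycle; should that be wrong, reroot at `y` instead and let `y` point to
`x`, which yields the opposite cycle (`IsRerooting.inv_of_follows`). The original assignment is
determined by the new one, `x`, and the starting point `u ≠ x` of the reversed path
(`IsRerooting.unique`), and `u` and its image are the ends of the bidirected edge; with one bit for
the chosen endpoint this gives the bound `2n(n-1)`. In both cases the number of bad events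
decreases, so assignments without bad events exist. On the cycle graph there is exactly one of
them, and explicit assignments show that both bounds are attained.
-/

noncomputable section

namespace BicyclePopping

/-! ### Extremal events in a product space -/

section Extremal

variable {V : Type*} {α : V → Type*}

open Classical in
/-- The assignment that agrees with `ρ` on `W` and with `σ` off `W`. -/
def splice (W : Set V) (ρ σ : ∀ v, α v) : ∀ v, α v := fun v => if v ∈ W then ρ v else σ v

theorem splice_of_mem {W : Set V} (ρ σ : ∀ v, α v) {v : V} (h : v ∈ W) :
    splice W ρ σ v = ρ v := by simp [splice, h]

theorem splice_of_notMem {W : Set V} (ρ σ : ∀ v, α v) {v : V} (h : v ∉ W) :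
    splice W ρ σ v = σ v := by simp [splice, h]

/-- The involution of the set of pairs of assignments that exchanges the values on `W`. -/
def exchange (W : Set V) : ((∀ v, α v) × (∀ v, α v)) ≃ ((∀ v, α v) × (∀ v, α v)) where
  toFun p := (splice W p.2 p.1, splice W p.1 p.2)
  invFun p := (splice W p.2 p.1, splice W p.1 p.2)
  left_inv p := by
    ext v <;> by_cases h : v ∈ W <;> simp [splice, h]
  right_inv p := by
    ext v <;> by_cases h : v ∈ W <;> simp [splice, h]

/-- Redrawing the variables in `W` makes them independent of everything else: a factor that only
involves the old values on `W` splits off. -/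
theorem sum_sum_splice [Fintype (∀ v, α v)] (W : Set V) {φ ψ : (∀ v, α v) → ℝ}
    (f : (∀ v, α v) → ℝ) (hφ : DependsOn φ W) (hψ : DependsOn ψ Wᶜ) :
    ∑ σ, ∑ ρ, φ σ * ψ σ * f (splice W ρ σ) = (∑ τ, ψ τ * f τ) * ∑ κ, φ κ := by
  rw [Finset.sum_mul_sum, ← Fintype.sum_prod_type', ← Fintype.sum_prod_type']
  refine Fintype.sum_equiv (exchange W) _ _ fun p => ?_
  have h1 : φ (exchange W p).2 = φ p.1 := hφ fun v hv => splice_of_mem _ _ hv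
  have h2 : ψ (exchange W p).1 = ψ p.1 := hψ fun v hv => splice_of_notMem _ _ hv
  rw [h1, h2]
  change _ = ψ p.1 * f (splice W p.2 p.1) * φ p.1
  ring

theorem card_mul_sum_mul [Fintype (∀ v, α v)] (W : Set V) {φ ψ : (∀ v, α v) → ℝ}
    (hφ : DependsOn φ W) (hψ : DependsOn ψ Wᶜ) :
    Fintype.card (∀ v, α v) * ∑ σ, φ σ * ψ σ = (∑ τ, ψ τ) * ∑ κ, φ κ := by
  have := sum_sum_splice W (fun _ => 1) hφ hψ
  simpa [Finset.mul_sum] using this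

/-- A family of events in a product space that is extremal in the sense of partial rejection
sampling: two distinct events that share a variable never occur together. -/
structure ExtremalEvents {V : Type*} (α : V → Type*) (I : Type*) where
  /-- the event with a given index -/
  event : I → Set (∀ v, α v)
  /-- the variables on which the event depends -/
  vars : I → Set V
  vars_nonempty : ∀ i, (vars i).Nonempty
  dependsOn : ∀ i, DependsOn (fun σ => σ ∈ event i) (vars i)
  eq_of_mem : ∀ {i j σ v}, σ ∈ event i → σ ∈ event j → v ∈ vars i → v ∈ vars j → i = j

namespace ExtremalEvents

variable {I : Type*} (E : ExtremalEvents α I)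

/-- The variables of the events that occur in `σ`. -/
def bad (σ : ∀ v, α v) : Set V := {v | ∃ i, σ ∈ E.event i ∧ v ∈ E.vars i}

/-- The assignments in which every event that occurs has a variable in `W`. -/
def avoid (W : Set V) : Set (∀ v, α v) := {σ | ∀ i, Disjoint (E.vars i) W → σ ∉ E.event i}

/-- Among the events without a variable in `W`, precisely the one with index `i` occurs. -/
def IsOnly (W : Set V) (i : I) (σ : ∀ v, α v) : Prop :=
  σ ∈ E.event i ∧ Disjoint (E.vars i) W ∧ ∀ j ≠ i, Disjoint (E.vars j) W → σ ∉ E.event j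

/-- The events within `W'` that occur cover `W'`, and each of them has a variable in `W`. -/
def Covers (W W' : Set V) (σ : ∀ v, α v) : Prop :=
  (∀ v ∈ W', ∃ i, σ ∈ E.event i ∧ v ∈ E.vars i ∧ E.vars i ⊆ W') ∧
    ∀ i, σ ∈ E.event i → E.vars i ⊆ W' → ¬ Disjoint (E.vars i) W

variable {E} in
theorem mem_event_congr {i : I} {σ τ : ∀ v, α v} (h : ∀ v ∈ E.vars i, σ v = τ v) :
    σ ∈ E.event i ↔ τ ∈ E.event i :=
  iff_of_eq (E.dependsOn i h)

theorem vars_subset_bad {i : I} {σ : ∀ v, α v} (h : σ ∈ E.event i) : E.vars i ⊆ E.bad σ :=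
  fun _ hv => ⟨i, h, hv⟩

theorem covers_congr (W : Set V) {W' : Set V} {σ τ : ∀ v, α v} (h : ∀ v ∈ W', σ v = τ v) :
    E.Covers W W' σ ↔ E.Covers W W' τ := by
  have key : ∀ i, E.vars i ⊆ W' → (σ ∈ E.event i ↔ τ ∈ E.event i) :=
    fun i hi => mem_event_congr fun v hv => h v (hi hv)
  unfold Covers
  grind

theorem avoid_congr {W : Set V} {σ τ : ∀ v, α v} (h : ∀ v ∈ Wᶜ, σ v = τ v) :
    σ ∈ E.avoid W ↔ τ ∈ E.avoid W := by
  have key : ∀ i, Disjoint (E.vars i) W → (σ ∈ E.event i ↔ τ ∈ E.event i) :=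
    fun i hi => mem_event_congr fun v hv => h v (Set.disjoint_left.1 hi hv)
  unfold avoid
  grind

theorem isOnly_congr {W : Set V} {i : I} {σ τ : ∀ v, α v} (h : ∀ v ∈ Wᶜ, σ v = τ v) :
    E.IsOnly W i σ ↔ E.IsOnly W i τ := by
  have key : ∀ i, Disjoint (E.vars i) W → (σ ∈ E.event i ↔ τ ∈ E.event i) :=
    fun i hi => mem_event_congr fun v hv => h v (Set.disjoint_left.1 hi hv)
  unfold IsOnly
  grind

/-- The condition that `σ` avoids the events off `W` and has bad set `W'` splits into a condition
on the values on `W'` and one on the values off `W'`. -/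
theorem mem_avoid_and_bad_eq_iff {W W' : Set V} {σ : ∀ v, α v} :
    σ ∈ E.avoid W ∧ E.bad σ = W' ↔ E.Covers W W' σ ∧ σ ∈ E.avoid W' := by
  constructor
  · rintro ⟨h, rfl⟩
    refine ⟨⟨fun v ⟨i, hi, hv⟩ => ⟨i, hi, hv, E.vars_subset_bad hi⟩,
      fun i hi _ hd => h i hd hi⟩, fun i hd hi => ?_⟩
    obtain ⟨v, hv⟩ := E.vars_nonempty i
    exact Set.disjoint_left.1 hd hv ⟨i, hi, hv⟩
  · rintro ⟨⟨h1, h2⟩, h3⟩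
    have hsub : ∀ j, σ ∈ E.event j → E.vars j ⊆ W' := by
      intro j hj
      by_contra hcon
      have : ¬ Disjoint (E.vars j) W' := fun hd => h3 j hd hj
      obtain ⟨v, hvj, hvW⟩ := Set.not_disjoint_iff.1 this
      obtain ⟨i, hi, hvi, hiW⟩ := h1 v hvW
      exact hcon (E.eq_of_mem hi hj hvi hvj ▸ hiW)
    refine ⟨fun j hd hj => h2 j hj (hsub j hj) hd, ?_⟩
    ext v
    constructor
    · rintro ⟨j, hj, hv⟩
      exact hsub j hj hv
    · intro hv
      obtain ⟨i, hi, hvi, -⟩ := h1 v hv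
      exact ⟨i, hi, hvi⟩

/-- Removing one occurring event `i` from the bad set: what is left is covered by the other
occurring events. -/
theorem covers_and_isOnly_iff {W W' : Set V} {i : I} {σ : ∀ v, α v} :
    E.Covers W W' σ ∧ E.IsOnly W' i σ ↔
      (σ ∈ E.event i ∧ ∀ j ≠ i, σ ∈ E.event j → ¬ Disjoint (E.vars j) W) ∧
        W' = E.bad σ \ E.vars i := by
  constructor
  · rintro ⟨⟨h1, h2⟩, h3, h4, h5⟩
    have hsub : ∀ j ≠ i, σ ∈ E.event j → E.vars j ⊆ W' := by
      intro j hji hj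
      by_contra hcon
      have : ¬ Disjoint (E.vars j) W' := fun hd => h5 j hji hd hj
      obtain ⟨v, hvj, hvW⟩ := Set.not_disjoint_iff.1 this
      obtain ⟨k, hk, hvk, hkW⟩ := h1 v hvW
      exact hcon (E.eq_of_mem hk hj hvk hvj ▸ hkW)
    refine ⟨⟨h3, fun j hji hj => h2 j hj (hsub j hji hj)⟩, ?_⟩
    ext v
    constructor
    · intro hv
      obtain ⟨k, hk, hvk, -⟩ := h1 v hv
      exact ⟨⟨k, hk, hvk⟩, fun hvi => Set.disjoint_left.1 h4 hvi hv⟩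
    · rintro ⟨⟨j, hj, hvj⟩, hvi⟩
      exact hsub j (fun h => hvi (h ▸ hvj)) hj hvj
  · rintro ⟨⟨h1, h2⟩, rfl⟩
    have hsub : ∀ j ≠ i, σ ∈ E.event j → E.vars j ⊆ E.bad σ \ E.vars i :=
      fun j hji hj v hv => ⟨⟨j, hj, hv⟩, fun hvi => hji (E.eq_of_mem hj h1 hv hvi)⟩
    refine ⟨⟨?_, ?_⟩, h1, Set.disjoint_sdiff_right, ?_⟩
    · rintro v ⟨⟨j, hj, hvj⟩, hvi⟩
      exact ⟨j, hj, hvj, hsub j (fun h => hvi (h ▸ hvj)) hj⟩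
    · intro j hj hjW
      refine h2 j ?_ hj
      rintro rfl
      obtain ⟨v, hv⟩ := E.vars_nonempty j
      exact (hjW hv).2 hv
    · intro j hji hd hj
      obtain ⟨v, hv⟩ := E.vars_nonempty j
      exact Set.disjoint_left.1 hd hv (hsub j hji hj hv)

section Counting

open Classical

/-- The indicator function of `E.avoid W`. -/
def avoidInd (W : Set V) (σ : ∀ v, α v) : ℝ := if σ ∈ E.avoid W then 1 else 0

/-- The indicator function of `E.Covers W W'`. -/
def coversInd (W W' : Set V) (σ : ∀ v, α v) : ℝ := if E.Covers W W' σ then 1 else 0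

/-- The number of variables of the only event off `W` that occurs in `σ`, and zero if there is not
exactly one such event. -/
def onlySize [Fintype I] (W : Set V) (σ : ∀ v, α v) : ℝ :=
  ∑ i, if E.IsOnly W i σ then ((E.vars i).ncard : ℝ) else 0

theorem dependsOn_avoidInd (W : Set V) : DependsOn (E.avoidInd W) Wᶜ := fun σ τ h => by
  simp only [avoidInd, E.avoid_congr h]

theorem dependsOn_coversInd (W W' : Set V) : DependsOn (E.coversInd W W') W' := fun σ τ h => by
  simp only [coversInd, E.covers_congr W h]

theorem dependsOn_onlySize [Fintype I] (W : Set V) : DependsOn (E.onlySize W) Wᶜ :=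
  fun σ τ h => by simp only [onlySize, E.isOnly_congr h]

theorem avoidInd_nonneg (W : Set V) (σ : ∀ v, α v) : 0 ≤ E.avoidInd W σ := by
  unfold avoidInd; split_ifs <;> norm_num

theorem avoidInd_mul_ite (W W' : Set V) (σ : ∀ v, α v) :
    (if E.bad σ = W' then E.avoidInd W σ else 0) = E.coversInd W W' σ * E.avoidInd W' σ := by
  have := E.mem_avoid_and_bad_eq_iff (W := W) (W' := W') (σ := σ)
  simp only [avoidInd, coversInd]
  grind

/-- The events that occur in `σ` have disjoint sets of variables. -/
theorem ncard_bad [Finite V] [Fintype I] (σ : ∀ v, α v) :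
    ((E.bad σ).ncard : ℝ) = ∑ i, if σ ∈ E.event i then ((E.vars i).ncard : ℝ) else 0 := by
  have hU : E.bad σ = ⋃ i ∈ {i | σ ∈ E.event i}, E.vars i := by
    ext v; simp [bad]
  have hd : {i | σ ∈ E.event i}.PairwiseDisjoint E.vars := fun i hi j hj hij =>
    Set.disjoint_left.2 fun v hv hv' => hij (E.eq_of_mem (σ := σ) hi hj hv hv')
  rw [hU, Set.Finite.ncard_biUnion (Set.toFinite _) (fun _ _ => Set.toFinite _) hd,
    finsum_eq_sum_of_fintype, Nat.cast_sum]
  refine Finset.sum_congr rfl fun i _ => ?_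
  by_cases h : σ ∈ E.event i <;> simp [h]

theorem finsum_coversInd_mul_onlySize [Finite V] [Fintype I] (W : Set V) (σ : ∀ v, α v) :
    ∑ᶠ W', E.coversInd W W' σ * E.onlySize W' σ =
      E.onlySize W σ + E.avoidInd W σ * (E.bad σ).ncard := by
  have := Fintype.ofFinite (Set V)
  have e : ∀ W', E.coversInd W W' σ * E.onlySize W' σ =
      ∑ i, if W' = E.bad σ \ E.vars i then
        (if σ ∈ E.event i ∧ ∀ j ≠ i, σ ∈ E.event j → ¬ Disjoint (E.vars j) W then
          ((E.vars i).ncard : ℝ) else 0) else 0 := by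
    intro W'
    unfold coversInd onlySize
    rw [Finset.mul_sum]
    refine Finset.sum_congr rfl fun i _ => ?_
    have := E.covers_and_isOnly_iff (W := W) (W' := W') (i := i) (σ := σ)
    grind
  rw [finsum_eq_sum_of_fintype, Finset.sum_congr rfl fun W' _ => e W', Finset.sum_comm,
    ncard_bad, onlySize, Finset.mul_sum, ← Finset.sum_add_distrib]
  refine Finset.sum_congr rfl fun i _ => ?_
  rw [Finset.sum_ite_eq' Finset.univ, if_pos (Finset.mem_univ _)]
  unfold avoidInd IsOnly avoid
  by_cases hi : σ ∈ E.event i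
  · by_cases hd : Disjoint (E.vars i) W
    · have : ¬ (∀ i, Disjoint (E.vars i) W → σ ∉ E.event i) := fun h => h i hd hi
      simp only [hi, hd, Set.mem_ofPred_eq, this, true_and, if_false, zero_mul, add_zero]
      grind
    · simp only [hi, hd, Set.mem_ofPred_eq, true_and, false_and, and_false, if_false, zero_add,
        if_true]
      grind
  · simp [hi]

variable [Fintype (∀ v, α v)]

/-- The mean of `f` over the uniform distribution on `E.avoid W`. -/
def mean (W : Set V) (f : (∀ v, α v) → ℝ) : ℝ :=
  (∑ σ, E.avoidInd W σ * f σ) / ∑ σ, E.avoidInd W σ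

/-- The conditional mean of `f` after one round of resampling, given the present assignment. -/
def step (f : (∀ v, α v) → ℝ) (σ : ∀ v, α v) : ℝ :=
  (∑ ρ, f (splice (E.bad σ) ρ σ)) / Fintype.card (∀ v, α v)

/-- The ratio between the weighted number of assignments with exactly one occurring event off `W`
and the number of those with none. -/
def ratio [Fintype I] (W : Set V) : ℝ :=
  (∑ σ, E.onlySize W σ) / ∑ σ, E.avoidInd W σ

theorem sum_avoidInd_pos (h : (E.avoid ∅).Nonempty) (W : Set V) : 0 < ∑ σ, E.avoidInd W σ := by
  obtain ⟨σ, hσ⟩ := h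
  refine Finset.sum_pos' (fun σ _ => E.avoidInd_nonneg W σ) ⟨σ, Finset.mem_univ _, ?_⟩
  have : σ ∈ E.avoid W := fun i _ => hσ i (by simp)
  simp [avoidInd, this]

/-- Splitting a sum over `E.avoid W` according to the bad set. -/
theorem sum_avoidInd_mul [Finite V] (W : Set V) (F : Set V → (∀ v, α v) → ℝ) :
    ∑ σ, E.avoidInd W σ * F (E.bad σ) σ =
      ∑ᶠ W', ∑ σ, E.coversInd W W' σ * E.avoidInd W' σ * F W' σ := by
  have := Fintype.ofFinite (Set V)
  rw [finsum_eq_sum_of_fintype, Finset.sum_comm]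
  refine Finset.sum_congr rfl fun σ _ => ?_
  simp only [← avoidInd_mul_ite, ite_mul, zero_mul]
  simp

/-- If the assignment is uniform on `E.avoid W` then, given its bad set `W'`, the assignment after
one round of resampling is uniform on `E.avoid W'`. -/
theorem mean_step [Finite V] (h : (E.avoid ∅).Nonempty) (W : Set V) (f : (∀ v, α v) → ℝ) :
    E.mean W (E.step f) = E.mean W fun σ => E.mean (E.bad σ) f := by
  have hN : (Fintype.card (∀ v, α v) : ℝ) ≠ 0 := by
    have : Nonempty (∀ v, α v) := ⟨h.some⟩
    exact_mod_cast Fintype.card_ne_zero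
  unfold mean
  congr 1
  have e1 := E.sum_avoidInd_mul W
    fun W' σ => (∑ ρ, f (splice W' ρ σ)) / Fintype.card (∀ v, α v)
  have e2 := E.sum_avoidInd_mul W fun W' _ => E.mean W' f
  unfold step
  unfold mean at e2
  rw [e1, e2]
  refine finsum_congr fun W' => ?_
  have h1 := sum_sum_splice W' f (E.dependsOn_coversInd W W') (E.dependsOn_avoidInd W')
  have h2 := card_mul_sum_mul W' (E.dependsOn_coversInd W W') (E.dependsOn_avoidInd W')
  have h3 := (E.sum_avoidInd_pos h W').ne'
  simp only [← Finset.mul_sum] at h1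
  simp only [← mul_div_assoc, ← Finset.sum_div, h1, ← Finset.sum_mul]
  rw [div_eq_div_iff hN h3]
  linear_combination (-(∑ σ, E.avoidInd W' σ * f σ)) * h2

/-- The fundamental identity: it makes `ratio ∅ - ratio W` the expected number of variables that
are resampled when the algorithm starts from the uniform distribution on `E.avoid W`. -/
theorem mean_ncard_bad [Finite V] [Fintype I] (h : (E.avoid ∅).Nonempty) (W : Set V) :
    E.mean W (fun σ => ((E.bad σ).ncard : ℝ)) + E.ratio W =
      E.mean W fun σ => E.ratio (E.bad σ) := by
  have hN : (Fintype.card (∀ v, α v) : ℝ) ≠ 0 := by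
    have : Nonempty (∀ v, α v) := ⟨h.some⟩
    exact_mod_cast Fintype.card_ne_zero
  have := Fintype.ofFinite (Set V)
  have e2 := E.sum_avoidInd_mul W fun W' _ => E.ratio W'
  have e3 : ∀ W', ∑ σ, E.coversInd W W' σ * E.avoidInd W' σ * E.ratio W' =
      ∑ σ, E.coversInd W W' σ * E.onlySize W' σ := by
    intro W'
    have h1 := card_mul_sum_mul W' (E.dependsOn_coversInd W W') (E.dependsOn_onlySize W')
    have h2 := card_mul_sum_mul W' (E.dependsOn_coversInd W W') (E.dependsOn_avoidInd W')
    have h3 := (E.sum_avoidInd_pos h W').ne'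
    rw [← Finset.sum_mul, ratio, mul_div_assoc', div_eq_iff h3]
    refine mul_left_cancel₀ hN ?_
    linear_combination (∑ σ, E.onlySize W' σ) * h2 - (∑ σ, E.avoidInd W' σ) * h1
  unfold mean
  rw [e2, finsum_congr e3, finsum_eq_sum_of_fintype, Finset.sum_comm]
  simp only [← finsum_eq_sum_of_fintype (α := Set V), finsum_coversInd_mul_onlySize]
  rw [Finset.sum_add_distrib, ratio]
  ring

theorem mean_add (W : Set V) (f g : (∀ v, α v) → ℝ) :
    E.mean W (fun σ => f σ + g σ) = E.mean W f + E.mean W g := by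
  simp only [mean, mul_add, Finset.sum_add_distrib, add_div]

theorem mean_const (h : (E.avoid ∅).Nonempty) (W : Set V) (c : ℝ) :
    E.mean W (fun _ => c) = c := by
  have h3 := (E.sum_avoidInd_pos h W).ne'
  rw [mean, ← Finset.sum_mul]
  field_simp

theorem mean_mono {W : Set V} {f g : (∀ v, α v) → ℝ} (h : ∀ σ, f σ ≤ g σ) :
    E.mean W f ≤ E.mean W g := by
  unfold mean
  gcongr with σ
  · exact Finset.sum_nonneg fun σ _ => E.avoidInd_nonneg W σ
  · exact E.avoidInd_nonneg W σ
  · exact h σ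

theorem mean_univ (f : (∀ v, α v) → ℝ) :
    E.mean Set.univ f = (∑ σ, f σ) / Fintype.card (∀ v, α v) := by
  have : ∀ σ, σ ∈ E.avoid Set.univ := fun σ i hd _ => by
    obtain ⟨v, hv⟩ := E.vars_nonempty i
    exact Set.disjoint_left.1 hd hv trivial
  simp [mean, avoidInd, this]

theorem ratio_univ [Fintype I] : E.ratio Set.univ = 0 := by
  have : ∀ i σ, ¬ E.IsOnly Set.univ i σ := fun i σ ⟨_, hd, _⟩ => by
    obtain ⟨v, hv⟩ := E.vars_nonempty i
    exact Set.disjoint_left.1 hd hv trivial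
  simp [ratio, onlySize, this]

theorem step_add (f g : (∀ v, α v) → ℝ) :
    E.step (fun σ => f σ + g σ) = fun σ => E.step f σ + E.step g σ := by
  funext σ
  simp only [step, Finset.sum_add_distrib, add_div]

theorem step_mono {f g : (∀ v, α v) → ℝ} (h : ∀ σ, f σ ≤ g σ) (σ : ∀ v, α v) :
    E.step f σ ≤ E.step g σ := by
  unfold step
  gcongr
  exact h _

theorem iterate_step_add (n : ℕ) (f g : (∀ v, α v) → ℝ) :
    E.step^[n] (fun σ => f σ + g σ) = fun σ => E.step^[n] f σ + E.step^[n] g σ := by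
  induction n generalizing f g with
  | zero => rfl
  | succ n ih => simp only [Function.iterate_succ_apply, step_add, ih]

theorem iterate_step_mono (n : ℕ) {f g : (∀ v, α v) → ℝ} (h : ∀ σ, f σ ≤ g σ) (σ : ∀ v, α v) :
    E.step^[n] f σ ≤ E.step^[n] g σ := by
  induction n generalizing f g with
  | zero => exact h σ
  | succ n ih => exact ih (E.step_mono h)

theorem iterate_step_const_mul (n : ℕ) (c : ℝ) (f : (∀ v, α v) → ℝ) :
    E.step^[n] (fun σ => c * f σ) = fun σ => c * E.step^[n] f σ := by
  induction n generalizing f with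
  | zero => rfl
  | succ n ih =>
    have : E.step (fun σ => c * f σ) = fun σ => c * E.step f σ := by
      funext σ
      simp only [step, ← Finset.mul_sum, mul_div_assoc]
    simp only [Function.iterate_succ_apply, this, ih]

/-- The number of variables to be resampled in a given round. -/
def badCard (σ : ∀ v, α v) : ℝ := (E.bad σ).ncard

/-- The function that, averaged over the assignments after a round, gives the expected number of
variables that are resampled in the later rounds. -/
def potential [Fintype I] (σ : ∀ v, α v) : ℝ := E.ratio ∅ - E.ratio (E.bad σ)

theorem mean_badCard_add_potential [Finite V] [Fintype I] (h : (E.avoid ∅).Nonempty)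
    (W : Set V) :
    E.mean W (fun σ => E.badCard σ + E.potential σ) = E.ratio ∅ - E.ratio W := by
  have h1 := E.mean_ncard_bad h W
  have h2 : E.mean W E.potential + E.mean W (fun σ => E.ratio (E.bad σ)) = E.ratio ∅ := by
    rw [← mean_add]
    simp only [potential, sub_add_cancel]
    exact E.mean_const h W _
  rw [mean_add]
  unfold badCard
  linarith

/-- In expectation, every round lowers the potential by the number of resampled variables. -/
theorem mean_iterate_step_add [Finite V] [Fintype I] (h : (E.avoid ∅).Nonempty) (W : Set V)
    (n : ℕ) :
    E.mean W (E.step^[n + 1] E.badCard) + E.mean W (E.step^[n + 1] E.potential) =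
      E.mean W (E.step^[n] E.potential) := by
  rw [← mean_add, ← iterate_step_add]
  induction n generalizing W with
  | zero =>
    simp only [Nat.zero_add, Function.iterate_one, Function.iterate_zero, id,
      E.mean_step h, E.mean_badCard_add_potential h]
    rfl
  | succ n ih =>
    rw [Function.iterate_succ_apply', E.mean_step h]
    simp only [ih]
    rw [← E.mean_step h, Function.iterate_succ_apply']

theorem mean_iterate_step_badCard_nonneg (h : (E.avoid ∅).Nonempty) (n : ℕ) :
    0 ≤ E.mean Set.univ (E.step^[n] E.badCard) := by
  have h1 : ∀ σ, 0 ≤ E.step^[n] E.badCard σ := fun σ => by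
    have := E.iterate_step_mono n (f := fun σ => 0 * E.badCard σ) (g := E.badCard)
      (fun σ => by simp [badCard]) σ
    rw [iterate_step_const_mul] at this
    simpa only [zero_mul] using this
  simpa [E.mean_const h] using E.mean_mono (W := Set.univ) (f := fun _ => 0) h1

/-- The expected total number of resampled variables: the sum over all rounds of the expected
number of variables resampled in that round. -/
theorem hasSum_mean_iterate_step [Finite V] [Fintype I] (h : (E.avoid ∅).Nonempty) :
    HasSum (fun n => E.mean Set.univ (E.step^[n] E.badCard)) (E.ratio ∅) := by
  set a : ℕ → ℝ := fun n => E.mean Set.univ (E.step^[n] E.badCard) with ha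
  set b : ℕ → ℝ := fun n => E.mean Set.univ (E.step^[n] E.potential) with hb
  have hsum : ∀ n, ∑ k ∈ Finset.range (n + 1), a k = E.ratio ∅ - b n := by
    intro n
    induction n with
    | zero =>
      have := E.mean_badCard_add_potential h Set.univ
      rw [mean_add, ratio_univ] at this
      simp only [zero_add, Finset.range_one, Finset.sum_singleton, ha, hb, Function.iterate_zero,
        id]
      linarith
    | succ n ih =>
      rw [Finset.sum_range_succ, ih]
      have := E.mean_iterate_step_add h Set.univ n
      simp only [ha, hb]
      linarith
  have ha0 : ∀ n, 0 ≤ a n := E.mean_iterate_step_badCard_nonneg h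
  -- the potential vanishes where no event occurs, so it is bounded by a multiple of `badCard`
  obtain ⟨C, hC⟩ : ∃ C : ℝ, ∀ W, |E.ratio ∅ - E.ratio W| ≤ C := by
    obtain ⟨C, hC⟩ := (Set.finite_range fun W => |E.ratio ∅ - E.ratio W|).bddAbove
    exact ⟨C, fun W => hC ⟨W, rfl⟩⟩
  have hpot : ∀ σ, |E.potential σ| ≤ C * E.badCard σ := by
    intro σ
    unfold potential badCard
    rcases (E.bad σ).eq_empty_or_nonempty with he | hne
    · simp [he]
    · have h1 : (1 : ℝ) ≤ (E.bad σ).ncard := by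
        exact_mod_cast (Set.ncard_pos (Set.toFinite _)).2 hne
      have h2 := hC (E.bad σ)
      nlinarith [abs_nonneg (E.ratio ∅ - E.ratio (E.bad σ))]
  have hC0 : 0 ≤ C := (abs_nonneg _).trans (hC ∅)
  have hba : ∀ n, |b n| ≤ C * a n := by
    intro n
    have e : ∀ c : ℝ, E.mean Set.univ (E.step^[n] fun σ => c * E.badCard σ) = c * a n := by
      intro c
      rw [iterate_step_const_mul]
      simp only [ha, mean, mul_left_comm _ c, ← Finset.mul_sum, mul_div_assoc]
    rw [abs_le]
    constructor
    · rw [← neg_mul, ← e]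
      exact E.mean_mono (E.iterate_step_mono n fun σ => by linarith [(abs_le.1 (hpot σ)).1])
    · rw [← e]
      exact E.mean_mono (E.iterate_step_mono n fun σ => (abs_le.1 (hpot σ)).2)
  have hle : ∀ n, a n ≤ Nat.card V := by
    intro n
    have h1 : ∀ n σ, E.step^[n] E.badCard σ ≤ Nat.card V := by
      intro n
      induction n with
      | zero =>
        intro σ
        simpa [badCard] using Set.ncard_le_card (E.bad σ)
      | succ n ih =>
        intro σ
        rw [Function.iterate_succ_apply']
        refine (E.step_mono ih σ).trans ?_
        have : Nonempty (∀ v, α v) := ⟨σ⟩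
        simp [step]
    simpa [E.mean_const h] using E.mean_mono (W := Set.univ) (h1 n)
  have hsummable : Summable a := by
    refine summable_of_sum_range_le (c := E.ratio ∅ + C * Nat.card V) ha0 fun n => ?_
    refine (Finset.sum_le_sum_of_subset_of_nonneg
      (Finset.range_mono (Nat.le_succ n)) fun i _ _ => ha0 i).trans ?_
    rw [hsum]
    have := (abs_le.1 (hba n)).1
    have := mul_le_mul_of_nonneg_left (hle n) hC0
    linarith
  have hb0 : Filter.Tendsto b Filter.atTop (nhds 0) :=
    squeeze_zero_norm hba (by simpa using hsummable.tendsto_atTop_zero.const_mul C)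
  have ht := (hsummable.hasSum.tendsto_sum_nat.comp (Filter.tendsto_add_atTop_nat 1))
  have ht' : Filter.Tendsto (fun n => ∑ k ∈ Finset.range (n + 1), a k) Filter.atTop
      (nhds (E.ratio ∅)) := by
    simp only [hsum]
    simpa using hb0.const_sub (E.ratio ∅)
  rw [← tendsto_nhds_unique ht ht']
  exact hsummable.hasSum

end Counting

end ExtremalEvents

end Extremal

/-! ### The law of the run -/

section Law

open ProbabilityTheory

theorem run_congr {V : Type*} {G : SimpleGraph V} (O : CycleOrientation G)
    {ω ω' : ℕ → Assignment G} {t : ℕ} (h : ∀ s ≤ t, ω s = ω' s) :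
    run O ω t = run O ω' t := by
  induction t with
  | zero => exact h 0 le_rfl
  | succ t ih =>
    rw [run, run, ih fun s hs => h s (hs.trans t.le_succ), h _ le_rfl]

variable {V : Type*} [Fintype V] {G : SimpleGraph V}

theorem assignmentLaw_singleton [Nonempty (Assignment G)] (σ : Assignment G) :
    assignmentLaw G {σ} = (Nat.card (Assignment G) : ℝ≥0∞)⁻¹ := by
  classical
  have : ∀ v, Nonempty (Arc G v) := fun v => ⟨(Classical.arbitrary (Assignment G)) v⟩
  have := fun v => Fintype.ofFinite (Arc G v)
  have : ∀ v, IsProbabilityMeasure (uniformOn (Set.univ : Set (Arc G v))) :=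
    fun v => isProbabilityMeasure_uniformOn Set.finite_univ Set.univ_nonempty
  rw [assignmentLaw, Measure.pi_singleton]
  simp only [uniformOn_univ, Measure.count_singleton, one_div]
  rw [Nat.card_pi, Nat.cast_prod, ENNReal.prod_inv_distrib]
  · simp
  · exact fun v _ w _ _ => Or.inr (ENNReal.natCast_ne_top _)

theorem isProbabilityMeasure_assignmentLaw [Nonempty (Assignment G)] :
    IsProbabilityMeasure (assignmentLaw G) := by
  have : ∀ v, Nonempty (Arc G v) := fun v => ⟨(Classical.arbitrary (Assignment G)) v⟩
  have : ∀ v, IsProbabilityMeasure (uniformOn (Set.univ : Set (Arc G v))) :=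
    fun v => isProbabilityMeasure_uniformOn Set.finite_univ Set.univ_nonempty
  unfold assignmentLaw
  infer_instance

/-- The expectation of a function of a uniformly random assignment is its average. -/
theorem lintegral_assignmentLaw [Nonempty (Assignment G)] [Fintype (Assignment G)]
    (f : Assignment G → ℝ) (hf : ∀ σ, 0 ≤ f σ) :
    ∫⁻ σ, ENNReal.ofReal (f σ) ∂(assignmentLaw G) =
      ENNReal.ofReal ((∑ σ, f σ) / Fintype.card (Assignment G)) := by
  rw [lintegral_fintype]
  simp only [assignmentLaw_singleton, ← Finset.sum_mul]
  rw [← ENNReal.ofReal_sum_of_nonneg fun σ _ => hf σ, ENNReal.ofReal_div_of_pos (by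
    exact_mod_cast Fintype.card_pos), Nat.card_eq_fintype_card, ENNReal.ofReal_natCast]
  rfl

variable (O : CycleOrientation G)

theorem measurable_run (t : ℕ) : Measurable fun ω => run O ω t := by
  induction t with
  | zero => exact measurable_pi_apply 0
  | succ t ih =>
    have : Measurable fun p : Assignment G × Assignment G => resample O p.1 p.2 :=
      measurable_of_finite _
    exact this.comp (ih.prodMk (measurable_pi_apply (t + 1)))

/-- The present assignment is independent of the next random values. -/
theorem indepFun_run [Nonempty (Assignment G)] (t : ℕ) :
    IndepFun (fun ω => run O ω t) (fun ω => ω (t + 1)) (sourceLaw G) := by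
  have := isProbabilityMeasure_assignmentLaw (G := G)
  have h1 : iIndepFun (fun (i : ℕ) (ω : ℕ → Assignment G) => ω i) (sourceLaw G) :=
    iIndepFun_infinitePi (X := fun _ σ => σ) fun _ => measurable_id
  have h2 := h1.indepFun_finset (Finset.range (t + 1)) {t + 1} (by simp) measurable_pi_apply
  -- the run up to time `t` as a function of the first `t + 1` random assignments
  let e : (Finset.range (t + 1) → Assignment G) → ℕ → Assignment G := fun r i =>
    if h : i ∈ Finset.range (t + 1) then r ⟨i, h⟩ else Classical.arbitrary _
  have he : Measurable e := by
    refine measurable_pi_lambda _ fun i => ?_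
    by_cases h : i ∈ Finset.range (t + 1)
    · simpa only [e, h, dif_pos] using measurable_pi_apply _
    · simpa only [e, h, dif_neg, not_false_eq_true] using measurable_const
  have h3 := h2.comp ((measurable_run O t).comp he)
    (measurable_pi_apply (⟨t + 1, by simp⟩ : ({t + 1} : Finset ℕ)))
  have h4 : (fun ω => run O ω t) = ((fun ω => run O ω t) ∘ e) ∘ fun ω i => ω i := by
    funext ω
    refine run_congr O fun s hs => ?_
    have : s ∈ Finset.range (t + 1) := Finset.mem_range.2 (Nat.lt_succ_of_le hs)
    simp only [e, this, dif_pos]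
  rw [h4]
  exact h3

theorem lintegral_run_succ [Nonempty (Assignment G)] (f : Assignment G → ℝ≥0∞) (t : ℕ) :
    ∫⁻ ω, f (run O ω (t + 1)) ∂(sourceLaw G) =
      ∫⁻ ω, ∫⁻ ρ, f (resample O (run O ω t) ρ) ∂(assignmentLaw G) ∂(sourceLaw G) := by
  have := isProbabilityMeasure_assignmentLaw (G := G)
  have hP : IsProbabilityMeasure (sourceLaw G) := by unfold sourceLaw; infer_instance
  have h := (indepFun_iff_map_prod_eq_prod_map_map (measurable_run O t).aemeasurable
    (measurable_pi_apply (t + 1)).aemeasurable).1 (indepFun_run O t)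
  have h1 : (sourceLaw G).map (fun ω => ω (t + 1)) = assignmentLaw G :=
    Measure.infinitePi_map_eval _ _
  have hm : Measurable fun p : Assignment G × Assignment G => f (resample O p.1 p.2) :=
    measurable_of_finite _
  calc ∫⁻ ω, f (run O ω (t + 1)) ∂(sourceLaw G)
      = ∫⁻ p, f (resample O p.1 p.2)
          ∂((sourceLaw G).map fun ω => (run O ω t, ω (t + 1))) := by
        rw [lintegral_map hm ((measurable_run O t).prodMk (measurable_pi_apply (t + 1)))]
        rfl
    _ = _ := by
        rw [h, h1, lintegral_prod _ hm.aemeasurable,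
          lintegral_map (measurable_of_finite _) (measurable_run O t)]

end Law

/-! ### Bicycle popping as an extremal family of events -/

section Follows

variable {V : Type*} {s : V → V} {c d : Equiv.Perm V}

/-- The map `s` agrees with the permutation `c` at the points that `c` moves. -/
def Follows (s : V → V) (c : Equiv.Perm V) : Prop := ∀ v, c v ≠ v → s v = c v

theorem Follows.iterate (h : Follows s c) {v : V} (hv : c v ≠ v) (n : ℕ) :
    s^[n] v = (c ^ n) v ∧ c (s^[n] v) ≠ s^[n] v := by
  induction n with
  | zero => exact ⟨rfl, hv⟩
  | succ n ih =>
    rw [Function.iterate_succ_apply', h _ ih.2, pow_succ', Equiv.Perm.mul_apply, ih.1]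
    refine ⟨rfl, fun hcon => ih.2 ?_⟩
    rw [ih.1]
    exact c.injective hcon

theorem Follows.exists_iterate [Finite V] (h : Follows s c) (hc : c.IsCycle) {v w : V}
    (hv : c v ≠ v) (hw : c w ≠ w) : ∃ n, s^[n] v = w := by
  obtain ⟨n, hn⟩ := hc.exists_pow_eq hv hw
  exact ⟨n, (h.iterate hv n).1.trans hn⟩

/-- The cycle of a map through a given point is unique. -/
theorem Follows.eq [Finite V] (h : Follows s c) (h' : Follows s d) (hc : c.IsCycle)
    (hd : d.IsCycle) {v : V} (hv : c v ≠ v) (hv' : d v ≠ v) : c = d := by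
  have key : ∀ {c d : Equiv.Perm V}, Follows s c → Follows s d → c.IsCycle → c v ≠ v →
      d v ≠ v → ∀ w, c w ≠ w → d w ≠ w := by
    intro c d h h' hc hv hv' w hw
    obtain ⟨n, rfl⟩ := h.exists_iterate hc hv hw
    exact (h'.iterate hv' n).2
  ext w
  by_cases hw : c w = w
  · by_cases hw' : d w = w
    · rw [hw, hw']
    · exact absurd hw (key h' h hd hv' hv w hw')
  · rw [← h w hw, ← h' w (key h h' hc hv hv' w hw)]

end Follows

section BadEvents

variable {V : Type*} {G : SimpleGraph V} (O : CycleOrientation G)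

/-- The end vertices of the arcs of an assignment. -/
def heads (σ : Assignment G) (v : V) : V := (σ v).head

theorem adj_heads (σ : Assignment G) (v : V) : G.Adj v (heads σ v) := (σ v).2

theorem heads_injective : Function.Injective (heads : Assignment G → V → V) :=
  fun _ _ h => funext fun v => Subtype.ext (congrFun h v)

/-- The assignment with given end vertices. -/
def ofHeads (s : V → V) (hs : ∀ v, G.Adj v (s v)) : Assignment G := fun v => ⟨s v, hs v⟩

@[simp]
theorem heads_ofHeads (s : V → V) (hs : ∀ v, G.Adj v (s v)) : heads (ofHeads s hs) = s := rfl

open Classical in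
/-- The cyclic permutation that belongs to a bad event: an edge is regarded as a cycle of length
two, so that in either case the event says that the permutation appears in the assignment. -/
def eventPerm : G.edgeSet ⊕ O.wrong → Equiv.Perm V
  | .inl e => Sym2.lift ⟨fun u v => Equiv.swap u v, fun u v => Equiv.swap_comm u v⟩ (e : Sym2 V)
  | .inr c => c

theorem badVars_eq (i : G.edgeSet ⊕ O.wrong) :
    badVars O i = {v | eventPerm O i v ≠ v} := by
  classical
  rcases i with ⟨e, he⟩ | c
  · induction e using Sym2.ind with
    | _ u v =>
      have huv : u ≠ v := G.ne_of_adj he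
      ext w
      simp only [badVars, eventPerm, Sym2.lift_mk, Set.mem_ofPred_eq, Sym2.mem_iff]
      rw [Equiv.swap_apply_ne_self_iff]
      tauto
  · rfl

theorem mem_badVars {i : G.edgeSet ⊕ O.wrong} {v : V} :
    v ∈ badVars O i ↔ eventPerm O i v ≠ v := by
  rw [badVars_eq]; rfl

theorem mem_badEvent {i : G.edgeSet ⊕ O.wrong} {σ : Assignment G} :
    σ ∈ badEvent O i ↔ Follows (heads σ) (eventPerm O i) := by
  classical
  rcases i with ⟨e, he⟩ | c
  · induction e using Sym2.ind with
    | _ u v =>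
      have huv : u ≠ v := G.ne_of_adj he
      simp only [badEvent, edgeEvent, eventPerm, Sym2.lift_mk, Follows, heads]
      constructor
      · intro h w hw
        rw [Equiv.swap_apply_ne_self_iff] at hw
        rcases hw.2 with rfl | rfl
        · rw [Equiv.swap_apply_left]; exact h _ _ rfl
        · rw [Equiv.swap_apply_right]; exact h _ _ Sym2.eq_swap
      · intro h w z hwz
        rcases Sym2.eq_iff.1 hwz with ⟨rfl, rfl⟩ | ⟨rfl, rfl⟩
        · simpa using h w (by simpa using huv.symm)
        · simpa using h w (by simpa using huv)
  · rfl

theorem isCycle_eventPerm (i : G.edgeSet ⊕ O.wrong) : (eventPerm O i).IsCycle := by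
  classical
  rcases i with ⟨e, he⟩ | c
  · induction e using Sym2.ind with
    | _ u v => exact Equiv.Perm.isCycle_swap (G.ne_of_adj he)
  · exact (O.isOrientedCycle c c.2).isCycle

theorem edge_ne_cycle (e : G.edgeSet) {c : Equiv.Perm V} (hc : IsOrientedCycle G c) :
    eventPerm O (.inl e) ≠ c := by
  intro h
  classical
  have h3 := hc.three_le
  rw [← h, ← badVars_eq] at h3
  obtain ⟨e, he⟩ := e
  induction e using Sym2.ind with
  | _ u v =>
    have : badVars O (.inl ⟨s(u, v), he⟩) = {u, v} := by
      ext w; simp [badVars]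
    rw [this] at h3
    have := Set.ncard_insert_le u {v}
    simp at this
    omega

theorem eventPerm_injective : Function.Injective (eventPerm O) := by
  intro i j hij
  have hv : badVars O i = badVars O j := by rw [badVars_eq, badVars_eq, hij]
  rcases i with e | c <;> rcases j with f | d
  · congr 1
    exact Subtype.ext (Sym2.ext fun v => Set.ext_iff.1 hv v)
  · exact absurd hij (edge_ne_cycle O e (O.isOrientedCycle d d.2))
  · exact absurd hij.symm (edge_ne_cycle O f (O.isOrientedCycle c c.2))
  · congr 1
    exact Subtype.ext hij

theorem badEvent_eq_of_mem [Finite V] {i j : G.edgeSet ⊕ O.wrong} {σ : Assignment G} {v : V}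
    (hi : σ ∈ badEvent O i) (hj : σ ∈ badEvent O j) (hvi : v ∈ badVars O i)
    (hvj : v ∈ badVars O j) : i = j :=
  eventPerm_injective O <| ((mem_badEvent O).1 hi).eq ((mem_badEvent O).1 hj)
    (isCycle_eventPerm O i) (isCycle_eventPerm O j) ((mem_badVars O).1 hvi) ((mem_badVars O).1 hvj)

/-- The bad events of bicycle popping are extremal: two of them that share a vertex would both be
the cycle of `σ` through that vertex. -/
def bicycleEvents [Finite V] : ExtremalEvents (fun v => Arc G v) (G.edgeSet ⊕ O.wrong) where
  event := badEvent O
  vars := badVars O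
  vars_nonempty i := by
    obtain ⟨v, hv, -⟩ := isCycle_eventPerm O i
    exact ⟨v, (mem_badVars O).2 hv⟩
  dependsOn i σ τ h := by
    simp only [mem_badEvent, eq_iff_iff]
    refine forall_congr' fun v => imp_congr_right fun hv => ?_
    rw [heads, heads, h v ((mem_badVars O).2 hv)]
  eq_of_mem hi hj hvi hvj := badEvent_eq_of_mem O hi hj hvi hvj

theorem avoid_empty [Finite V] : (bicycleEvents O).avoid ∅ = noBad O := by
  ext σ
  simp [ExtremalEvents.avoid, noBad, bicycleEvents]

theorem isOnly_empty [Finite V] (i : G.edgeSet ⊕ O.wrong) (σ : Assignment G) :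
    (bicycleEvents O).IsOnly ∅ i σ ↔ σ ∈ onlyBad O i := by
  simp only [ExtremalEvents.IsOnly, onlyBad, bicycleEvents, Set.disjoint_empty, true_and,
    forall_const, Set.mem_ofPred_eq]

theorem onlyBad_inj {i j : G.edgeSet ⊕ O.wrong} {σ : Assignment G} (hi : σ ∈ onlyBad O i)
    (hj : σ ∈ onlyBad O j) : i = j := by
  by_contra h
  exact hj.2 i h hi.1

theorem ncard_edgeVarPairs [Finite V] [Fintype G.edgeSet] :
    (edgeVarPairs O).ncard =
      ∑ e, (onlyBad O (.inl e)).ncard * (badVars O (.inl e)).ncard := by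
  have : edgeVarPairs O = ⋃ e, onlyBad O (.inl e) ×ˢ badVars O (.inl e) := by
    ext p; simp [edgeVarPairs]
  rw [this, Set.ncard_iUnion_of_finite (fun _ => Set.toFinite _), finsum_eq_sum_of_fintype]
  · simp only [Set.ncard_prod]
  · intro e f hef
    refine Set.disjoint_left.2 fun p hp hq => hef ?_
    exact Sum.inl_injective (onlyBad_inj O hp.1 hq.1)

theorem ncard_cycleVarPairs [Finite V] [Fintype O.wrong] :
    (cycleVarPairs O).ncard =
      ∑ c, (onlyBad O (.inr c)).ncard * (badVars O (.inr c)).ncard := by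
  have : cycleVarPairs O = ⋃ c, onlyBad O (.inr c) ×ˢ badVars O (.inr c) := by
    ext p; simp [cycleVarPairs]
  rw [this, Set.ncard_iUnion_of_finite (fun _ => Set.toFinite _), finsum_eq_sum_of_fintype]
  · simp only [Set.ncard_prod]
  · intro e f hef
    refine Set.disjoint_left.2 fun p hp hq => hef ?_
    exact Sum.inr_injective (onlyBad_inj O hp.1 hq.1)

theorem ratio_empty [Finite V] [Fintype (Assignment G)] [Fintype (G.edgeSet ⊕ O.wrong)] :
    (bicycleEvents O).ratio ∅ =
      ((edgeVarPairs O).ncard + (cycleVarPairs O).ncard : ℝ) / (noBad O).ncard := by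
  classical
  have := Fintype.ofFinite G.edgeSet
  have := Fintype.ofFinite O.wrong
  unfold ExtremalEvents.ratio
  congr 1
  · simp only [ExtremalEvents.onlySize, isOnly_empty]
    rw [Finset.sum_comm]
    have : ∀ i, ∑ σ, (if σ ∈ onlyBad O i then (((bicycleEvents O).vars i).ncard : ℝ) else 0) =
        (onlyBad O i).ncard * (badVars O i).ncard := by
      intro i
      rw [← Finset.sum_filter, Finset.sum_const, nsmul_eq_mul,
        Set.ncard_eq_toFinset_card' (onlyBad O i)]
      congr 3
      ext σ; simp
    rw [Finset.sum_congr rfl fun i _ => this i, ncard_edgeVarPairs, ncard_cycleVarPairs]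
    push_cast
    convert Fintype.sum_sum_type _
  · simp only [ExtremalEvents.avoidInd, avoid_empty]
    rw [Finset.sum_boole, Set.ncard_eq_toFinset_card']
    congr 2
    ext σ; simp

end BadEvents

section Expectation

variable {V : Type*} [Fintype V] {G : SimpleGraph V} (O : CycleOrientation G)

/-- The expectation of a function of the assignment after `t` rounds. -/
theorem lintegral_run [Nonempty (Assignment G)] [Fintype (Assignment G)]
    (f : Assignment G → ℝ) (hf : ∀ σ, 0 ≤ f σ) (t : ℕ) :
    ∫⁻ ω, ENNReal.ofReal (f (run O ω t)) ∂(sourceLaw G) =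
      ENNReal.ofReal ((bicycleEvents O).mean Set.univ ((bicycleEvents O).step^[t] f)) := by
  have := isProbabilityMeasure_assignmentLaw (G := G)
  induction t generalizing f with
  | zero =>
    have h1 : (sourceLaw G).map (fun ω => ω 0) = assignmentLaw G :=
      Measure.infinitePi_map_eval _ _
    have h2 := lintegral_map (μ := sourceLaw G) (f := fun σ => ENNReal.ofReal (f σ))
      (measurable_of_finite _) (measurable_pi_apply 0)
    rw [h1, lintegral_assignmentLaw f hf] at h2
    rw [ExtremalEvents.mean_univ]
    exact h2.symm
  | succ t ih =>
    rw [lintegral_run_succ O fun σ => ENNReal.ofReal (f σ)]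
    have h1 : ∀ σ, ∫⁻ ρ, ENNReal.ofReal (f (resample O σ ρ)) ∂(assignmentLaw G) =
        ENNReal.ofReal ((bicycleEvents O).step f σ) :=
      fun σ => lintegral_assignmentLaw (fun ρ => f (resample O σ ρ)) fun ρ => hf _
    simp only [h1]
    exact ih _ fun σ => div_nonneg (Finset.sum_nonneg fun _ _ => hf _) (Nat.cast_nonneg _)

theorem expectedResampled_eq (h : (noBad O).Nonempty) :
    expectedResampled O =
      ((edgeVarPairs O).ncard : ℝ≥0∞) / ((noBad O).ncard : ℝ≥0∞) +
        ((cycleVarPairs O).ncard : ℝ≥0∞) / ((noBad O).ncard : ℝ≥0∞) := by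
  have := Fintype.ofFinite (Assignment G)
  have := Fintype.ofFinite (G.edgeSet ⊕ O.wrong)
  have : Nonempty (Assignment G) := ⟨h.some⟩
  have hpos : (0 : ℝ) < (noBad O).ncard := by
    exact_mod_cast (Set.ncard_pos (Set.toFinite _)).2 h
  have hsum := (bicycleEvents O).hasSum_mean_iterate_step (by rwa [avoid_empty])
  have hterm : ∀ t, ∫⁻ ω, ((Bad O (run O ω t)).ncard : ℝ≥0∞) ∂(sourceLaw G) = ENNReal.ofReal
      ((bicycleEvents O).mean Set.univ
        ((bicycleEvents O).step^[t] (bicycleEvents O).badCard)) := by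
    intro t
    rw [← lintegral_run O (bicycleEvents O).badCard fun σ => Nat.cast_nonneg _]
    refine lintegral_congr fun ω => ?_
    rw [ExtremalEvents.badCard, ENNReal.ofReal_natCast]
    rfl
  have h0 := (bicycleEvents O).mean_iterate_step_badCard_nonneg (by rwa [avoid_empty])
  unfold expectedResampled numResampled
  rw [lintegral_tsum fun t => ?_]
  · simp only [hterm]
    rw [← ENNReal.ofReal_tsum_of_nonneg h0 hsum.summable, hsum.tsum_eq, ratio_empty,
      ENNReal.ofReal_div_of_pos hpos, ENNReal.ofReal_add (by positivity) (by positivity),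
      ENNReal.add_div]
    simp only [ENNReal.ofReal_natCast]
  · exact ((measurable_of_finite fun σ => ((Bad O σ).ncard : ℝ≥0∞)).comp
      (measurable_run O t)).aemeasurable

end Expectation

/-! ### Reversing a cycle, and rerooting a tree -/

/-- A set injects into a finite set along a relation that is total on it and injective. -/
theorem ncard_le_ncard_of_rel {α β : Type*} {A : Set α} {B : Set β} (R : α → β → Prop)
    (hB : B.Finite) (h1 : ∀ a ∈ A, ∃ b ∈ B, R a b)
    (h2 : ∀ a ∈ A, ∀ a' ∈ A, ∀ b ∈ B, R a b → R a' b → a = a') : A.ncard ≤ B.ncard := by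
  rcases B.eq_empty_or_nonempty with rfl | ⟨b, -⟩
  · have : A = ∅ := Set.eq_empty_of_forall_notMem fun a ha => (h1 a ha).choose_spec.1
    simp [this]
  have : Nonempty β := ⟨b⟩
  choose! f hf hR using h1
  exact Set.ncard_le_ncard_of_injOn f hf
    (fun a ha a' ha' h => h2 a ha a' ha' (f a) (hf a ha) (hR a ha) (h ▸ hR a' ha')) hB

section ReverseCycle

variable {V : Type*} {G : SimpleGraph V} (O : CycleOrientation G)

open Classical in
/-- The map obtained from `s` by sending the points moved by `c` backwards along `c`. -/
def reverseAlong (c : Equiv.Perm V) (s : V → V) (v : V) : V := if c v ≠ v then c⁻¹ v else s v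

theorem reverseAlong_of_ne {c : Equiv.Perm V} {s : V → V} {v : V} (h : c v ≠ v) :
    reverseAlong c s v = c⁻¹ v := if_pos h

theorem reverseAlong_of_eq {c : Equiv.Perm V} {s : V → V} {v : V} (h : c v = v) :
    reverseAlong c s v = s v := if_neg (not_not.2 h)

theorem inv_apply_ne_iff {c : Equiv.Perm V} {v : V} : c⁻¹ v ≠ v ↔ c v ≠ v := by
  rw [not_iff_not, Equiv.Perm.inv_eq_iff_eq, eq_comm]

theorem follows_reverseAlong (c : Equiv.Perm V) (s : V → V) :
    Follows (reverseAlong c s) c⁻¹ := fun _ hv =>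
  reverseAlong_of_ne (inv_apply_ne_iff.1 hv)

theorem adj_reverseAlong {c : Equiv.Perm V} {s : V → V} (hc : ∀ v, c v ≠ v → G.Adj v (c v))
    (hs : ∀ v, G.Adj v (s v)) (v : V) : G.Adj v (reverseAlong c s v) := by
  by_cases hv : c v = v
  · rw [reverseAlong_of_eq hv]; exact hs v
  · rw [reverseAlong_of_ne hv]
    have h := hc (c⁻¹ v) (by
      intro h
      exact hv (by simpa using (congrArg c h.symm).symm))
    simpa using h.symm

/-- Reversing a cycle with a wrong orientation removes this bad event and creates no new one. -/
theorem exists_reverse_cycle [Finite V] (σ : Assignment G) (c : O.wrong) :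
    ∃ τ : Assignment G, heads τ = reverseAlong c (heads σ) ∧
      ∀ i, τ ∈ badEvent O i → σ ∈ badEvent O i ∧ i ≠ .inr c := by
  have hc := O.isOrientedCycle c c.2
  have hc' : IsOrientedCycle G (c : Equiv.Perm V)⁻¹ := by
    refine ⟨hc.isCycle.inv, ?_, fun v hv => ?_⟩
    · simpa only [inv_apply_ne_iff] using hc.three_le
    · have := adj_reverseAlong hc.adj (adj_heads σ) v
      rwa [reverseAlong_of_ne (inv_apply_ne_iff.1 hv)] at this
  refine ⟨ofHeads _ (adj_reverseAlong hc.adj (adj_heads σ)), rfl, fun i hi => ?_⟩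
  rw [mem_badEvent, heads_ofHeads] at hi
  have hdisj : ∀ v, eventPerm O i v ≠ v → (c : Equiv.Perm V) v = v := by
    intro v hv
    by_contra hcv
    have heq := hi.eq (follows_reverseAlong _ _) (isCycle_eventPerm O i) hc.isCycle.inv hv
      (inv_apply_ne_iff.2 hcv)
    rcases i with e | d
    · exact edge_ne_cycle O e hc' heq
    · have h1 : (d : Equiv.Perm V) = (c : Equiv.Perm V)⁻¹ := heq
      exact (O.mem_iff c hc).1 c.2 (h1 ▸ d.2)
  constructor
  · rw [mem_badEvent]
    intro v hv
    rw [← hi v hv, reverseAlong_of_eq (hdisj v hv)]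
  · rintro rfl
    obtain ⟨v, hv, -⟩ := hc.isCycle
    exact hv (hdisj v hv)

/-- Given a vertex of the reversed cycle, the original assignment can be recovered. -/
theorem ncard_cycleVarPairs_le [Fintype V] :
    (cycleVarPairs O).ncard ≤ Fintype.card V * (noBad O).ncard := by
  have h := ncard_le_ncard_of_rel (A := cycleVarPairs O) (B := noBad O ×ˢ (Set.univ : Set V))
    (fun p q => p.2 = q.2 ∧ ∃ c : Equiv.Perm V, c.IsCycle ∧ c p.2 ≠ p.2 ∧ Follows (heads p.1) c ∧
      heads q.1 = reverseAlong c (heads p.1)) (Set.toFinite _) ?_ ?_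
  · rwa [Set.ncard_prod, Set.ncard_univ, Nat.card_eq_fintype_card, mul_comm] at h
  · rintro ⟨σ, v⟩ ⟨c, hσ, hv⟩
    obtain ⟨τ, hτ, hbad⟩ := exists_reverse_cycle O σ c
    refine ⟨(τ, v), ⟨fun i hi => ?_, trivial⟩, rfl, c, isCycle_eventPerm O (.inr c), hv,
      (mem_badEvent O).1 hσ.1, hτ⟩
    exact hσ.2 i (hbad i hi).2 (hbad i hi).1
  · rintro ⟨σ, v⟩ - ⟨σ', v'⟩ - ⟨τ, w⟩ - ⟨hv, c, hc, hcv, hf, hτ⟩ ⟨hv', c', hc', hcv', hf', hτ'⟩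
    dsimp only at hv hv' hcv hcv' hf hf' hτ hτ'
    subst hv hv'
    have e1 : Follows (heads τ) c⁻¹ := hτ ▸ follows_reverseAlong c _
    have e2 : Follows (heads τ) c'⁻¹ := hτ' ▸ follows_reverseAlong c' _
    obtain rfl : c = c' := inv_injective <|
      e1.eq e2 hc.inv hc'.inv (inv_apply_ne_iff.2 hcv) (inv_apply_ne_iff.2 hcv')
    have : σ = σ' := by
      refine heads_injective (funext fun z => ?_)
      by_cases hz : c z = z
      · rw [← reverseAlong_of_eq (s := heads σ) hz, ← reverseAlong_of_eq (s := heads σ') hz,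
          ← hτ, ← hτ']
      · rw [hf z hz, hf' z hz]
    rw [this]

end ReverseCycle

section Reroot

variable {V : Type*} {s s' : V → V} {x y u : V}

/-- The orbit of `x` under `s` runs, without repetition, into a pair of points that are exchanged
by `s`, the last of which is `u`; and `s'` traverses this orbit backwards, from `u` to `x`, and
agrees with `s` off the orbit. The value of `s'` at `x` is arbitrary. In terms of graphs: the tree
rooted at the bidirected edge is rerooted at `x`, and `x` gets a new arc. -/
def IsRerooting (s s' : V → V) (x u : V) : Prop :=
  ∃ k : ℕ, s^[k + 1] x = u ∧ s u = s^[k] x ∧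
    (∀ i j, i ≤ k + 1 → j ≤ k + 1 → s^[i] x = s^[j] x → i = j) ∧
    (∀ i ≤ k, s' (s^[i + 1] x) = s^[i] x) ∧ ∀ v, (∀ i ≤ k + 1, v ≠ s^[i] x) → s' v = s v

/-- The original map is recovered from the rerooted one and the two ends of the reversed path. -/
theorem IsRerooting.unique {t : V → V} (h : IsRerooting s s' x u) (h' : IsRerooting t s' x u) :
    s = t := by
  have key : ∀ {s : V → V} {k : ℕ}, s^[k + 1] x = u →
      (∀ i ≤ k, s' (s^[i + 1] x) = s^[i] x) → ∀ j ≤ k + 1, s'^[j] u = s^[k + 1 - j] x := by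
    intro s k hu hs' j hj
    induction j with
    | zero => exact hu.symm
    | succ j ih =>
      rw [Function.iterate_succ_apply', ih (by omega)]
      have := hs' (k - j) (by omega)
      rwa [show k - j + 1 = k + 1 - j by omega, show k - j = k + 1 - (j + 1) by omega] at this
  obtain ⟨k, hu, hsu, hinj, hrev, hoff⟩ := h
  obtain ⟨l, hu', htu, hinj', hrev', hoff'⟩ := h'
  have hk := key hu hrev
  have hl := key hu' hrev'
  obtain rfl : k = l := by
    rcases lt_trichotomy k l with hlt | rfl | hlt
    · have h1 := hk (k + 1) le_rfl
      rw [hl (k + 1) (by omega), Nat.sub_self] at h1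
      have := hinj' _ 0 (by omega) (by omega) h1
      omega
    · rfl
    · have h1 := hl (l + 1) le_rfl
      rw [hk (l + 1) (by omega), Nat.sub_self] at h1
      have := hinj _ 0 (by omega) (by omega) h1
      omega
  have hst : ∀ i ≤ k + 1, s^[i] x = t^[i] x := by
    intro i hi
    have h1 := hk (k + 1 - i) (by omega)
    rw [hl (k + 1 - i) (by omega), show k + 1 - (k + 1 - i) = i by omega] at h1
    exact h1.symm
  funext v
  by_cases hv : ∀ i ≤ k + 1, v ≠ s^[i] x
  · rw [← hoff v hv, ← hoff' v fun i hi => hst i hi ▸ hv i hi]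
  · push Not at hv
    obtain ⟨i, hi, rfl⟩ := hv
    rcases hi.lt_or_eq with hlt | rfl
    · rw [← Function.iterate_succ_apply' s, hst (i + 1) (by omega), hst i hi,
        Function.iterate_succ_apply']
    · rw [hu, hsu, htu, hst k (by omega)]

theorem IsRerooting.ne (h : IsRerooting s s' x u) : x ≠ u := by
  obtain ⟨k, rfl, -, hinj, -⟩ := h
  intro h
  have := hinj 0 (k + 1) (by omega) le_rfl h
  omega

open Classical in
/-- A point whose orbit reaches the exchanged pair `p`, `q` can be made the new root. -/
theorem exists_isRerooting {p q : V} (hpq : p ≠ q) (hp : s p = q) (hq : s q = p)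
    (hx : ∃ n, s^[n] x = p) (y : V) :
    ∃ s' u, IsRerooting s s' x u ∧ s' x = y ∧ s(u, s' u) = s(p, q) := by
  have hx' : ∃ n, s^[n] x = p ∨ s^[n] x = q := hx.imp fun n hn => Or.inl hn
  set k := Nat.find hx' with hk
  have hmin : ∀ n, s^[n] x = p ∨ s^[n] x = q → k ≤ n := fun n hn => Nat.find_min' hx' hn
  have hkx : s^[k] x = p ∨ s^[k] x = q := Nat.find_spec hx'
  have hk1 : s (s^[k + 1] x) = s^[k] x := by
    rw [Function.iterate_succ_apply']
    rcases hkx with h | h <;> rw [h] <;> simp [hp, hq]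
  have hk1x : s^[k + 1] x = p ∨ s^[k + 1] x = q := by
    rw [Function.iterate_succ_apply']
    rcases hkx with h | h <;> rw [h] <;> simp [hp, hq]
  have hk1ne : s^[k + 1] x ≠ s^[k] x := by
    rw [Function.iterate_succ_apply']
    rcases hkx with h | h <;> rw [h] <;> simp [hp, hq, hpq, hpq.symm]
  have hlt : ∀ i j, i < j → j ≤ k + 1 → s^[i] x ≠ s^[j] x := by
    intro i j hij hj h
    have h1 : s^[k + 1 - j + i] x = s^[k + 1] x := by
      rw [Function.iterate_add_apply, h, ← Function.iterate_add_apply]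
      congr 1
      omega
    have h2 := hmin (k + 1 - j + i) (by rw [h1]; exact hk1x)
    rw [show k + 1 - j + i = k by omega] at h1
    exact hk1ne h1.symm
  have hinj : ∀ i j, i ≤ k + 1 → j ≤ k + 1 → s^[i] x = s^[j] x → i = j := by
    intro i j hi hj h
    rcases lt_trichotomy i j with h' | h' | h'
    · exact absurd h (hlt i j h' hj)
    · exact h'
    · exact absurd h.symm (hlt j i h' hi)
  let r : V → V := fun v =>
    if v = x then y else if h : ∃ i ≤ k, v = s^[i + 1] x then s^[h.choose] x else s v
  have hr : ∀ i ≤ k, r (s^[i + 1] x) = s^[i] x := by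
    intro i hi
    have h0 : s^[i + 1] x ≠ x := fun h => by
      have := hinj (i + 1) 0 (by omega) (by omega) h
      omega
    have h1 : ∃ j ≤ k, s^[i + 1] x = s^[j + 1] x := ⟨i, hi, rfl⟩
    have h2 := hinj _ _ (by omega) (by have := h1.choose_spec.1; omega) h1.choose_spec.2
    simp only [r, h0, if_false, h1, dif_pos]
    congr 1
    have := Nat.succ_injective h2
    rw [← this]
  refine ⟨r, s^[k + 1] x, ⟨k, rfl, hk1, hinj, hr, fun v hv => ?_⟩, by simp [r], ?_⟩
  · have h0 : v ≠ x := hv 0 (by omega)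
    have h1 : ¬ ∃ j ≤ k, v = s^[j + 1] x := fun ⟨j, hj, h⟩ => hv (j + 1) (by omega) h
    simp only [r, h0, if_false, h1, dif_neg, not_false_eq_true]
  · rw [hr k le_rfl, Function.iterate_succ_apply']
    rcases hkx with h | h <;> rw [h]
    · rw [hp, Sym2.eq_swap]
    · rw [hq]

/-- Apart from the new arc at `x`, rerooting uses the same undirected edges. -/
theorem IsRerooting.edge (h : IsRerooting s s' x u) {v : V} (hv : v ≠ x) :
    s v = s' v ∨ s (s' v) = v := by
  obtain ⟨k, hu, hsu, hinj, hrev, hoff⟩ := h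
  by_cases hv' : ∀ i ≤ k + 1, v ≠ s^[i] x
  · exact Or.inl (hoff v hv').symm
  · push Not at hv'
    obtain ⟨i, hi, rfl⟩ := hv'
    rcases i with _ | i
    · exact absurd rfl hv
    · right
      rw [hrev i (by omega), ← Function.iterate_succ_apply' s]

theorem IsRerooting.edge' (h : IsRerooting s s' x u) (v : V) :
    s' v = s v ∨ s' (s v) = v := by
  obtain ⟨k, hu, hsu, hinj, hrev, hoff⟩ := h
  by_cases hv' : ∀ i ≤ k + 1, v ≠ s^[i] x
  · exact Or.inl (hoff v hv')
  · push Not at hv'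
    obtain ⟨i, hi, rfl⟩ := hv'
    rcases hi.lt_or_eq with hlt | rfl
    · right
      rw [← Function.iterate_succ_apply' s, hrev i (by omega)]
    · left
      rw [hrev k le_rfl, hu, hsu]

/-- A cycle of the rerooted map either uses the new arc or is an old one. -/
theorem IsRerooting.follows [Finite V] (h : IsRerooting s s' x u) {c : Equiv.Perm V}
    (hc : Follows s' c) : c x ≠ x ∨ Follows s c ∧ c u = u := by
  obtain ⟨k, hu, hsu, hinj, hrev, hoff⟩ := h
  by_cases hx : c x = x
  · right
    have hz : ∀ i ≤ k + 1, c (s^[i] x) = s^[i] x := by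
      intro i hi
      induction i with
      | zero => exact hx
      | succ i ih =>
        by_contra hcon
        have := (hc.iterate hcon 1).2
        rw [Function.iterate_one, hrev i (by omega)] at this
        exact this (ih (by omega))
    refine ⟨fun v hv => ?_, hu ▸ hz (k + 1) le_rfl⟩
    rw [← hc v hv, hoff v]
    rintro i hi rfl
    exact hv (hz i hi)
  · exact Or.inl hx

/-- The set of points whose orbit reaches `u` is left and entered by no arc of `s`. -/
theorem exists_iterate_apply_iff (hu : s (s u) = u) (v : V) :
    (∃ n, s^[n] (s v) = u) ↔ ∃ n, s^[n] v = u := by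
  constructor
  · rintro ⟨n, hn⟩
    exact ⟨n + 1, hn⟩
  · rintro ⟨n, hn⟩
    rcases n with _ | n
    · refine ⟨1, ?_⟩
      obtain rfl : v = u := hn
      exact hu
    · exact ⟨n, hn⟩

/-- If the new arc leaves the component of `u`, no cycle uses it. -/
theorem IsRerooting.not_follows_of_leave [Finite V] (h : IsRerooting s s' x u)
    (hy : ¬ ∃ n, s^[n] (s' x) = u) {c : Equiv.Perm V} (hcyc : c.IsCycle) (hc : Follows s' c) :
    c x = x := by
  by_contra hx
  obtain ⟨k, hu, hsu, hinj, hrev, hoff⟩ := h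
  have huu : s (s u) = u := by rw [hsu, ← hu, Function.iterate_succ_apply']
  have hxT : ∃ n, s^[n] x = u := ⟨k + 1, hu⟩
  have hzT : ∀ i, ∃ n, s^[n] (s^[i] x) = u := by
    intro i
    induction i with
    | zero => exact hxT
    | succ i ih => rwa [Function.iterate_succ_apply', exists_iterate_apply_iff huu]
  have hcx : c (s' x) ≠ s' x := (hc.iterate hx 1).2
  obtain ⟨n, hn⟩ := hc.exists_iterate hcyc hcx hx
  have hnot : ∀ n, ¬ ∃ m, s^[m] (s'^[n] (s' x)) = u := by
    intro n
    induction n with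
    | zero => exact hy
    | succ n ih =>
      rw [Function.iterate_succ_apply', hoff, exists_iterate_apply_iff huu]
      · exact ih
      · intro i _ hi
        exact ih (hi ▸ hzT i)
  exact hnot n (by rwa [hn])

/-- If the new edge is not used by `s`, it is not bidirected after rerooting. -/
theorem IsRerooting.apply_apply_ne (h : IsRerooting s s' x u) (hxy : s' x ≠ x)
    (h1 : s x ≠ s' x) (h2 : s (s' x) ≠ x) : s' (s' x) ≠ x := by
  intro hcon
  have := h.edge hxy
  rw [hcon] at this
  exact this.elim h2 h1

/-- Adding an unused edge `xy` to a component closes a single cycle; rerooting at `x` and rerooting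
at `y` give it opposite orientations. -/
theorem IsRerooting.inv_of_follows [Finite V] {t : V → V} {w : V} (h : IsRerooting s s' x u)
    (h' : IsRerooting s t y w) (hxy : x ≠ y) (hsx : s' x = y) (hty : t y = x) (h1 : s x ≠ y)
    (h2 : s y ≠ x) {c d : Equiv.Perm V} (hc : c.IsCycle) (hd : d.IsCycle) (hcf : Follows s' c)
    (hdf : Follows t d) (hcx : c x ≠ x) (hdy : d y ≠ y) : d = c⁻¹ := by
  have hdyx : d y = x := (hdf y hdy).symm.trans hty
  -- `d` is not an edge, since the edge `xy` is not used by `s`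
  have hdd : ∀ v, d v ≠ v → d (d v) ≠ v := by
    intro v hv hcon
    obtain ⟨n, rfl⟩ := hd.exists_pow_eq hdy hv
    have h3 : d (d y) = y := by
      apply (d ^ n).injective
      have e : d ^ n * (d * d) = d * (d * d ^ n) := by
        rw [← mul_assoc, ← pow_succ, ← pow_succ, pow_succ', pow_succ']
      exact (Equiv.ext_iff.1 e y).trans hcon
    have h4 : t x = y := by
      rw [hdf x (by rw [← hdyx, h3]; exact fun h => hdy h.symm), ← hdyx, h3]
    exact h'.apply_apply_ne (by rw [hty]; exact hxy) (by rwa [hty]) (by rwa [hty])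
      (by rw [hty, h4])
  have hback : ∀ n : ℕ, s' (d ((d ^ n) y)) = (d ^ n) y := by
    intro n
    induction n with
    | zero => simpa [hdyx] using hsx
    | succ n ih =>
      rw [pow_succ', Equiv.Perm.mul_apply]
      set v := (d ^ n) y with hv
      have hvne : d v ≠ v := by
        rw [hv, ← (hdf.iterate hdy n).1]; exact (hdf.iterate hdy n).2
      have hwne : d (d v) ≠ d v := fun h => hvne (d.injective h)
      by_cases hwy : d v = y
      · rw [hwy, hdyx, hsx]
      have hnot : s' (d v) ≠ d (d v) := by
        rw [ih]; exact fun h => hdd v hvne h.symm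
      have htw : t (d v) = d (d v) := hdf _ hwne
      rcases h'.edge hwy with he | he
      · rw [htw] at he
        have := h.edge' (d v)
        rw [he] at this
        exact this.resolve_left hnot
      · rw [htw] at he
        have := h.edge' (d (d v))
        rw [he] at this
        exact this.elim id fun h => absurd h hnot
  have hdinv : Follows s' d⁻¹ := by
    intro v hv
    have hv' : d (d⁻¹ v) ≠ d⁻¹ v := by simpa using hv.symm
    obtain ⟨n, hn⟩ := hd.exists_pow_eq hdy hv'
    have := hback n
    rw [hn] at this
    simpa using this
  have hx : d⁻¹ x ≠ x := by
    rw [show d⁻¹ x = y by rw [← hdyx]; exact d.symm_apply_apply y]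
    exact hxy.symm
  rw [hcf.eq hdinv hc hd.inv hcx hx, inv_inv]

end Reroot

/-! ### Removing a bidirected edge, and the bounds -/

section RemoveEdge

theorem IsRerooting.adj {V : Type*} {G : SimpleGraph V} {σ : Assignment G} {s' : V → V} {x u : V}
    (h : IsRerooting (heads σ) s' x u) (hx : G.Adj x (s' x)) (v : V) : G.Adj v (s' v) := by
  by_cases hv : v = x
  · exact hv ▸ hx
  · rcases h.edge hv with he | he
    · exact he ▸ adj_heads σ v
    · have := adj_heads σ (s' v)
      rw [he] at this
      exact this.symm

variable {V : Type*} [Fintype V] {G : SimpleGraph V} (O : CycleOrientation G)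

/-- There is an edge, not used by `s`, from the component of `u` to some vertex: if the component
is everything, this is where `m ≥ n` is needed, since the bidirected edge is used twice. -/
theorem exists_unused_edge (hG : G.Connected) (hm : Fintype.card V ≤ G.edgeSet.ncard)
    {s : V → V} {u : V} (huu : s (s u) = u) (hne : s u ≠ u) :
    ∃ x y, (∃ n, s^[n] x = u) ∧ G.Adj x y ∧ s x ≠ y ∧ s y ≠ x := by
  by_cases hT : ∀ v, ∃ n, s^[n] v = u
  · let f : V → Sym2 V := fun v => s(v, s v)
    have h1 : (f '' {u}ᶜ).ncard < G.edgeSet.ncard := by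
      have h2 := Set.ncard_image_le (f := f) (Set.toFinite ({u}ᶜ : Set V))
      have h3 := Set.ncard_add_ncard_compl ({u} : Set V)
      rw [Set.ncard_singleton, Nat.card_eq_fintype_card] at h3
      omega
    obtain ⟨e, he, hef⟩ := Set.exists_mem_notMem_of_ncard_lt_ncard h1 (Set.toFinite _)
    induction e using Sym2.ind with
    | _ x y =>
      have key : ∀ v, f v ≠ s(x, y) := by
        intro v hv
        by_cases hvu : v = u
        · refine hef ⟨s u, hne, ?_⟩
          rw [← hv, hvu]
          simp only [f, huu]
          exact Sym2.eq_swap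
        · exact hef ⟨v, hvu, hv⟩
      exact ⟨x, y, hT x, he, fun h => key x (by simp [f, h]),
        fun h => key y (by simp only [f, h]; exact Sym2.eq_swap)⟩
  · push Not at hT
    obtain ⟨w, hw⟩ := hT
    obtain ⟨p⟩ := hG.preconnected u w
    obtain ⟨⟨⟨x, y⟩, hadj⟩, -, hx, hy⟩ := p.exists_boundary_dart {v | ∃ n, s^[n] v = u}
      ⟨0, rfl⟩ (fun ⟨n, hn⟩ => hw n hn)
    refine ⟨x, y, hx, hadj, fun h => hy ?_, fun h => hy ?_⟩
    · change ∃ n, s^[n] y = u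
      rw [← h, exists_iterate_apply_iff huu]
      exact hx
    · change ∃ n, s^[n] y = u
      rw [← exists_iterate_apply_iff huu, h]
      exact hx

/-- An assignment with a bidirected edge can be rerooted in such a way that this bad event
disappears and no new one arises. If the new arc closes a cycle in its wrong orientation, the new
arc is to be reversed, which gives the opposite cycle. -/
theorem exists_reroot (hG : G.Connected) (hm : Fintype.card V ≤ G.edgeSet.ncard)
    {σ : Assignment G} {e : G.edgeSet} (hσ : σ ∈ badEvent O (.inl e)) :
    ∃ (τ : Assignment G) (x u : V), IsRerooting (heads σ) (heads τ) x u ∧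
      s(u, heads τ u) = (e : Sym2 V) ∧
      ∀ i, τ ∈ badEvent O i → σ ∈ badEvent O i ∧ i ≠ .inl e := by
  obtain ⟨⟨p, q⟩, he⟩ := e
  have hpq : p ≠ q := G.ne_of_adj he
  have hp : heads σ p = q := hσ p q rfl
  have hq : heads σ q = p := hσ q p Sym2.eq_swap
  obtain ⟨x, y, hxT, hadj, hxy, hyx⟩ := exists_unused_edge hG hm (s := heads σ) (u := p)
    (by rw [hp, hq]) (by rw [hp]; exact hpq.symm)
  -- it is enough that the new arc lies on no bad cycle
  have key : ∀ {s' : V → V} {x u : V} (h : IsRerooting (heads σ) s' x u)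
      (hadj : G.Adj x (s' x)) (_ : s(u, s' u) = s(p, q))
      (_ : ∀ i, Follows s' (eventPerm O i) → eventPerm O i x = x),
      ∃ (τ : Assignment G) (x u : V), IsRerooting (heads σ) (heads τ) x u ∧
        s(u, heads τ u) = s(p, q) ∧
        ∀ i, τ ∈ badEvent O i → σ ∈ badEvent O i ∧ i ≠ .inl ⟨s(p, q), he⟩ := by
    intro s' x u h hadj hu hx
    refine ⟨ofHeads s' (h.adj hadj), x, u, h, hu, fun i hi => ?_⟩
    rw [mem_badEvent, heads_ofHeads] at hi
    obtain ⟨h1, h2⟩ := (h.follows hi).resolve_left fun hne => hne (hx i hi)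
    refine ⟨(mem_badEvent O).2 h1, ?_⟩
    rintro rfl
    have h3 : u ∈ badVars O (.inl ⟨s(p, q), he⟩) := by
      change u ∈ s(p, q)
      rw [← hu]
      exact Sym2.mem_mk_left _ _
    exact (mem_badVars O).1 h3 h2
  -- a bad event that uses the new arc is a cycle
  have hcyc : ∀ {s' : V → V} {x y u : V}, IsRerooting (heads σ) s' x u → s' x = y → G.Adj x y →
      heads σ x ≠ y → heads σ y ≠ x → ∀ i, Follows s' (eventPerm O i) → eventPerm O i x ≠ x →
      eventPerm O i ∈ O.wrong := by
    intro s' x y u h hx hadj hxy hyx i hi hix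
    rcases i with ⟨⟨a, b⟩, hab⟩ | c
    · exfalso
      have h1 := h.apply_apply_ne (by rw [hx]; exact (G.ne_of_adj hadj).symm) (by rwa [hx])
        (by rwa [hx])
      apply h1
      classical
      have h2 := (hi.iterate hix 1).2
      rw [Function.iterate_one] at h2
      rw [hi _ h2, hi _ hix]
      exact Equiv.swap_apply_self (i := a) (j := b) (a := x)
    · exact c.2
  obtain ⟨s₁, u₁, h₁, hs₁, hu₁⟩ := exists_isRerooting hpq hp hq hxT y
  by_cases hyT : ∃ n, (heads σ)^[n] y = p
  · obtain ⟨s₂, u₂, h₂, hs₂, hu₂⟩ := exists_isRerooting hpq hp hq hyT x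
    by_cases hbad₁ : ∀ i, Follows s₁ (eventPerm O i) → eventPerm O i x = x
    · exact key h₁ (hs₁ ▸ hadj) hu₁ hbad₁
    by_cases hbad₂ : ∀ i, Follows s₂ (eventPerm O i) → eventPerm O i y = y
    · exact key h₂ (hs₂ ▸ hadj.symm) hu₂ hbad₂
    exfalso
    push Not at hbad₁ hbad₂
    obtain ⟨i, hi, hix⟩ := hbad₁
    obtain ⟨j, hj, hjy⟩ := hbad₂
    have hinv := h₁.inv_of_follows h₂ (G.ne_of_adj hadj) hs₁ hs₂ hxy hyx (isCycle_eventPerm O i)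
      (isCycle_eventPerm O j) hi hj hix hjy
    have hiw := hcyc h₁ hs₁ hadj hxy hyx i hi hix
    have hjw := hcyc h₂ hs₂ hadj.symm hyx hxy j hj hjy
    exact (O.mem_iff _ (O.isOrientedCycle _ hiw)).1 hiw (hinv ▸ hjw)
  · refine key h₁ (hs₁ ▸ hadj) hu₁ fun i hi =>
      h₁.not_follows_of_leave ?_ (isCycle_eventPerm O i) hi
    rintro ⟨n, hn⟩
    rw [hs₁] at hn
    -- `u₁` is `p` or `q`, so it is in the component of `p`
    have hu : u₁ ∈ s(p, q) := hu₁ ▸ Sym2.mem_mk_left _ _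
    rcases Sym2.mem_iff.1 hu with h | h
    · exact hyT ⟨n, hn.trans h⟩
    · exact hyT ⟨n + 1, by rw [Function.iterate_succ_apply', hn, h, hq]⟩

theorem exists_fewer (hG : G.Connected) (hm : Fintype.card V ≤ G.edgeSet.ncard)
    {σ : Assignment G} {i : G.edgeSet ⊕ O.wrong} (hσ : σ ∈ badEvent O i) :
    ∃ τ : Assignment G, ∀ j, τ ∈ badEvent O j → σ ∈ badEvent O j ∧ j ≠ i := by
  rcases i with e | c
  · obtain ⟨τ, x, u, -, -, h⟩ := exists_reroot O hG hm hσ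
    exact ⟨τ, h⟩
  · obtain ⟨τ, -, h⟩ := exists_reverse_cycle O σ c
    exact ⟨τ, h⟩

theorem nonempty_assignment (hG : G.Connected) (hm : Fintype.card V ≤ G.edgeSet.ncard) :
    Nonempty (Assignment G) := by
  have hne := hG.nonempty
  have h1 : 0 < G.edgeSet.ncard := Fintype.card_pos.trans_le hm
  obtain ⟨⟨a, b⟩, hab⟩ := (Set.ncard_pos (Set.toFinite _)).1 h1
  have : Nontrivial V := ⟨a, b, G.ne_of_adj hab⟩
  choose s hs using hG.preconnected.exists_adj_of_nontrivial
  exact ⟨ofHeads s hs⟩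

theorem noBad_nonempty (hG : G.Connected) (hm : Fintype.card V ≤ G.edgeSet.ncard) :
    (noBad O).Nonempty := by
  obtain ⟨σ₀⟩ := nonempty_assignment hG hm
  obtain ⟨σ, -, hσ⟩ := Set.exists_min_image Set.univ
    (fun σ : Assignment G => {i | σ ∈ badEvent O i}.ncard) (Set.toFinite _) ⟨σ₀, trivial⟩
  refine ⟨σ, fun i hi => ?_⟩
  obtain ⟨τ, hτ⟩ := exists_fewer O hG hm hi
  refine (hσ τ trivial).not_gt (Set.ncard_lt_ncard ?_ (Set.toFinite _))
  exact ⟨fun j hj => (hτ j hj).1, fun h => (hτ i (h hi)).2 rfl⟩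

/-- An assignment with a single bidirected edge and an endpoint of this edge are encoded by the
rerooted assignment, the two distinct ends of the reversed path, and one bit. -/
theorem ncard_edgeVarPairs_le (hG : G.Connected) (hm : Fintype.card V ≤ G.edgeSet.ncard) :
    (edgeVarPairs O).ncard ≤
      2 * Fintype.card V * (Fintype.card V - 1) * (noBad O).ncard := by
  classical
  have h := ncard_le_ncard_of_rel (A := edgeVarPairs O)
    (B := noBad O ×ˢ (((Finset.univ : Finset V).offDiag : Set (V × V)) ×ˢ (Set.univ : Set Bool)))
    (fun p q => IsRerooting (heads p.1) (heads q.1) q.2.1.1 q.2.1.2 ∧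
      p.2 = if q.2.2 then q.2.1.2 else heads q.1 q.2.1.2) (Set.toFinite _) ?_ ?_
  · rw [Set.ncard_prod, Set.ncard_prod, Set.ncard_coe_finset, Finset.offDiag_card, Set.ncard_univ,
      Nat.card_eq_fintype_card, Fintype.card_bool, Finset.card_univ] at h
    refine h.trans_eq ?_
    rw [← Nat.mul_sub_one]
    ring
  · rintro ⟨σ, v⟩ ⟨e, hσ, hv⟩
    obtain ⟨τ, x, u, hre, hu, hbad⟩ := exists_reroot O hG hm hσ.1
    have hτ : τ ∈ noBad O := fun i hi => hσ.2 i (hbad i hi).2 (hbad i hi).1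
    have hxu : (x, u) ∈ ((Finset.univ : Finset V).offDiag : Set (V × V)) := by
      simpa using hre.ne
    have hv' : v ∈ (e : Sym2 V) := hv
    rw [← hu, Sym2.mem_iff] at hv'
    rcases hv' with h | h
    · exact ⟨(τ, ((x, u), true)), ⟨hτ, hxu, trivial⟩, hre, by simpa using h⟩
    · exact ⟨(τ, ((x, u), false)), ⟨hτ, hxu, trivial⟩, hre, by simpa using h⟩
  · rintro ⟨σ, v⟩ - ⟨σ', v'⟩ - ⟨τ, ⟨x, u⟩, b⟩ - ⟨h1, h2⟩ ⟨h1', h2'⟩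
    exact Prod.ext (heads_injective (h1.unique h1')) (h2.trans h2'.symm)

theorem expectedResampled_le (hG : G.Connected) (hm : Fintype.card V ≤ G.edgeSet.ncard) :
    expectedResampled O ≤
      ENNReal.ofReal (2 * (Fintype.card V : ℝ) ^ 2 - (Fintype.card V : ℝ)) := by
  have hne := noBad_nonempty O hG hm
  have hcard : 1 ≤ Fintype.card V := Fintype.card_pos_iff.2 hG.nonempty
  rw [expectedResampled_eq O hne, ← ENNReal.add_div]
  have h0 : ((noBad O).ncard : ℝ≥0∞) ≠ 0 := by
    exact_mod_cast ((Set.ncard_pos (Set.toFinite _)).2 hne).ne'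
  rw [ENNReal.div_le_iff h0 (ENNReal.natCast_ne_top _)]
  have h1 := add_le_add (ncard_edgeVarPairs_le O hG hm) (ncard_cycleVarPairs_le O)
  have h2 : (2 * (Fintype.card V : ℝ) ^ 2 - (Fintype.card V : ℝ)) =
      ((2 * Fintype.card V * (Fintype.card V - 1) + Fintype.card V : ℕ) : ℝ) := by
    push_cast [Nat.cast_sub hcard]
    ring
  rw [h2, ENNReal.ofReal_natCast]
  rw [← Nat.add_mul] at h1
  exact_mod_cast h1

end RemoveEdge

/-! ### The cycle graph -/

section CycleGraph

variable {n : ℕ}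

theorem fin_add_one_ne_sub_one (v : Fin (n + 3)) : v + 1 ≠ v - 1 := by
  intro h
  have h1 : (1 : Fin (n + 3)) + 1 = 0 := by
    have := congrArg (fun w => w - v + 1) h
    simpa [add_comm, sub_eq_add_neg, add_assoc] using this
  have h2 := congrArg Fin.val h1
  rw [Fin.val_add] at h2
  simp [Nat.mod_eq_of_lt (show 2 < n + 3 by omega)] at h2

theorem cycleGraph_adj_iff {u v : Fin (n + 3)} :
    (SimpleGraph.cycleGraph (n + 3)).Adj u v ↔ v = u + 1 ∨ v = u - 1 := by
  rw [SimpleGraph.cycleGraph_adj, sub_eq_iff_eq_add, sub_eq_iff_eq_add, or_comm, add_comm 1 u]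
  refine or_congr_right ⟨fun h => ?_, fun h => ?_⟩
  · rw [h]; simp
  · rw [h]; simp

theorem card_le_ncard_edgeSet_cycleGraph :
    Fintype.card (Fin (n + 3)) ≤ (SimpleGraph.cycleGraph (n + 3)).edgeSet.ncard := by
  rw [← Nat.card_eq_fintype_card, ← Set.ncard_univ]
  refine Set.ncard_le_ncard_of_injOn (fun v => s(v, v + 1))
    (fun v _ => cycleGraph_adj_iff.2 (Or.inl rfl)) ?_ (Set.toFinite _)
  intro v _ w _ h
  rcases Sym2.eq_iff.1 h with h | h
  · exact h.1
  · refine absurd ?_ (fin_add_one_ne_sub_one v)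
    rw [h.2, h.1]
    simp

theorem finRotate_ne (v : Fin (n + 3)) : finRotate (n + 3) v ≠ v := by
  rw [finRotate_apply]
  simp

theorem isOrientedCycle_finRotate :
    IsOrientedCycle (SimpleGraph.cycleGraph (n + 3)) (finRotate (n + 3)) where
  isCycle := isCycle_finRotate
  three_le := by
    have : {v | finRotate (n + 3) v ≠ v} = Set.univ := by
      ext v; simp
    rw [this, Set.ncard_univ]
    simp
  adj v _ := by rw [finRotate_apply]; exact cycleGraph_adj_iff.2 (Or.inl rfl)

variable (O : CycleOrientation (SimpleGraph.cycleGraph (n + 3)))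

/-- Without bidirected edges all arcs go round the cycle in the same direction. -/
theorem heads_eq_of_noBad {σ : Assignment (SimpleGraph.cycleGraph (n + 3))} (hσ : σ ∈ noBad O) :
    heads σ = finRotate (n + 3) ∨ heads σ = (finRotate (n + 3))⁻¹ := by
  have hstep : ∀ v, heads σ v = finRotate _ v →
      heads σ (finRotate _ v) = finRotate _ (finRotate _ v) := by
    intro v hv
    simp only [finRotate_apply] at hv ⊢
    refine (cycleGraph_adj_iff.1 (adj_heads σ (v + 1))).resolve_right fun h => ?_
    rw [add_sub_cancel_right] at h
    refine hσ (.inl ⟨s(v, v + 1), cycleGraph_adj_iff.2 (Or.inl rfl)⟩) fun a b hab => ?_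
    rcases Sym2.eq_iff.1 hab with ⟨rfl, rfl⟩ | ⟨rfl, rfl⟩
    · exact hv
    · exact h
  by_cases h : ∃ v, heads σ v = finRotate _ v
  · left
    obtain ⟨v, hv⟩ := h
    funext w
    obtain ⟨k, rfl⟩ := isCycle_finRotate.exists_pow_eq (finRotate_ne v) (finRotate_ne w)
    induction k with
    | zero => exact hv
    | succ k ih =>
      rw [pow_succ', Equiv.Perm.mul_apply]
      exact hstep _ ih
  · right
    funext v
    push Not at h
    have h1 := (cycleGraph_adj_iff.1 (adj_heads σ v)).resolve_left fun h' =>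
      h v (by rw [finRotate_apply]; exact h')
    rw [h1, eq_comm, Equiv.Perm.inv_eq_iff_eq, finRotate_apply, sub_add_cancel]

/-- One orientation `c` of the full cycle is wrong, and the only assignment without bad events
follows the other one. -/
theorem exists_wrong_orientation :
    ∃ c ∈ O.wrong, (∀ v, c v ≠ v) ∧ ∀ σ ∈ noBad O, heads σ = c⁻¹ := by
  have hr := isOrientedCycle_finRotate (n := n)
  by_cases h : finRotate (n + 3) ∈ O.wrong
  · refine ⟨_, h, finRotate_ne, fun σ hσ => (heads_eq_of_noBad O hσ).resolve_left fun h' => ?_⟩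
    exact hσ (.inr ⟨_, h⟩) fun v _ => congrFun h' v
  · have h1 : (finRotate (n + 3))⁻¹ ∈ O.wrong := by
      by_contra hcon
      exact h ((O.mem_iff _ hr).2 hcon)
    refine ⟨_, h1, fun v => inv_apply_ne_iff.2 (finRotate_ne v), fun σ hσ => ?_⟩
    rw [inv_inv]
    refine (heads_eq_of_noBad O hσ).resolve_right fun h' => ?_
    exact hσ (.inr ⟨_, h1⟩) fun v _ => congrFun h' v

theorem ncard_noBad_cycleGraph_le : (noBad O).ncard ≤ 1 := by
  obtain ⟨c, -, -, h⟩ := exists_wrong_orientation O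
  rw [Set.ncard_le_one_iff]
  intro σ τ hσ hτ
  exact heads_injective ((h σ hσ).trans (h τ hτ).symm)

theorem le_ncard_cycleVarPairs_cycleGraph : n + 3 ≤ (cycleVarPairs O).ncard := by
  obtain ⟨c, hc, hne, -⟩ := exists_wrong_orientation O
  have hcyc := O.isOrientedCycle c hc
  let σ : Assignment (SimpleGraph.cycleGraph (n + 3)) := ofHeads c fun v => hcyc.adj v (hne v)
  have hf : σ ∈ badEvent O (.inr ⟨c, hc⟩) := fun v _ => rfl
  have hσ : σ ∈ onlyBad O (.inr ⟨c, hc⟩) := by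
    refine ⟨hf, fun j hj hjσ => hj ?_⟩
    obtain ⟨v, hv, -⟩ := isCycle_eventPerm O j
    exact badEvent_eq_of_mem O hjσ hf ((mem_badVars O).2 hv) (hne v)
  have hsub : ({σ} : Set _) ×ˢ (Set.univ : Set (Fin (n + 3))) ⊆ cycleVarPairs O := by
    rintro ⟨τ, v⟩ ⟨rfl, -⟩
    exact ⟨⟨c, hc⟩, hσ, hne v⟩
  have := Set.ncard_le_ncard hsub (Set.toFinite _)
  rw [Set.ncard_prod, Set.ncard_singleton, Set.ncard_univ] at this
  simpa using this

/-- The map on the vertices of the cycle that goes up on the `j + 1` vertices from `a` on and goes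
down on the other vertices. -/
def arcsFrom (a : Fin (n + 3)) (j : Fin (n + 2)) (v : Fin (n + 3)) : Fin (n + 3) :=
  if (v - a).val ≤ j.val then v + 1 else v - 1

theorem arcsFrom_eq_add_one_iff {a : Fin (n + 3)} {j : Fin (n + 2)} {v : Fin (n + 3)} :
    arcsFrom a j v = v + 1 ↔ (v - a).val ≤ j.val := by
  unfold arcsFrom
  split_ifs with h
  · simp [h]
  · simpa [h] using (fin_add_one_ne_sub_one v).symm

theorem arcsFrom_eq_sub_one_iff {a : Fin (n + 3)} {j : Fin (n + 2)} {v : Fin (n + 3)} :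
    arcsFrom a j v = v - 1 ↔ j.val < (v - a).val := by
  unfold arcsFrom
  split_ifs with h
  · exact iff_of_false (fin_add_one_ne_sub_one v) (by omega)
  · exact iff_of_true rfl (by omega)

theorem val_add_one_sub {a v : Fin (n + 3)} (h : (v - a).val ≤ n + 1) :
    (v + 1 - a).val = (v - a).val + 1 := by
  rw [add_sub_right_comm]
  exact Fin.val_add_one_of_lt (by rw [Fin.lt_def]; simp; omega)

theorem val_sub_one_sub {a v : Fin (n + 3)} (h : v ≠ a) :
    (v - 1 - a).val = (v - a).val - 1 := by
  rw [sub_right_comm]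
  exact Fin.val_sub_one_of_ne_zero (sub_ne_zero.2 h)

/-- The place where `arcsFrom a j` changes from going up to going down. -/
theorem arcsFrom_peak_iff {a : Fin (n + 3)} {j : Fin (n + 2)} {v : Fin (n + 3)} :
    arcsFrom a j v = v + 1 ∧ arcsFrom a j (v + 1) = v ↔ (v - a).val = j.val := by
  have h1 := arcsFrom_eq_sub_one_iff (a := a) (j := j) (v := v + 1)
  rw [add_sub_cancel_right] at h1
  rw [h1, arcsFrom_eq_add_one_iff]
  have := j.2
  constructor
  · rintro ⟨h2, h3⟩
    rw [val_add_one_sub (by omega)] at h3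
    omega
  · intro h
    rw [val_add_one_sub (by omega)]
    omega

/-- The place where `arcsFrom a j` changes from going down to going up. -/
theorem arcsFrom_valley_iff {a : Fin (n + 3)} {j : Fin (n + 2)} {v : Fin (n + 3)} :
    arcsFrom a j v = v + 1 ∧ arcsFrom a j (v - 1) = v - 1 - 1 ↔ v = a := by
  rw [arcsFrom_eq_sub_one_iff, arcsFrom_eq_add_one_iff]
  constructor
  · rintro ⟨h1, h2⟩
    by_contra h
    rw [val_sub_one_sub h] at h2
    omega
  · rintro rfl
    rw [sub_right_comm, sub_self, zero_sub, Fin.coe_neg_one]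
    have := j.2
    exact ⟨by simp, by omega⟩

theorem adj_arcsFrom (a : Fin (n + 3)) (j : Fin (n + 2)) (v : Fin (n + 3)) :
    (SimpleGraph.cycleGraph (n + 3)).Adj v (arcsFrom a j v) := by
  rw [cycleGraph_adj_iff]
  unfold arcsFrom
  split_ifs <;> simp

/-- All orbits of `arcsFrom a j` lead to the peak. -/
theorem exists_iterate_arcsFrom {a p : Fin (n + 3)} {j : Fin (n + 2)} (hp : (p - a).val = j.val)
    (v : Fin (n + 3)) : ∃ k, (arcsFrom a j)^[k] v = p := by
  have hup : ∀ m, ∀ v : Fin (n + 3), (v - a).val + m = j.val → ∃ k, (arcsFrom a j)^[k] v = p := by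
    intro m
    induction m with
    | zero =>
      intro v hv
      refine ⟨0, sub_left_injective (b := a) (Fin.ext ?_)⟩
      exact hv.trans hp.symm
    | succ m ih =>
      intro v hv
      have := j.2
      obtain ⟨k, hk⟩ := ih (v + 1) (by rw [val_add_one_sub (by omega)]; omega)
      exact ⟨k + 1, by
        rw [Function.iterate_succ_apply, arcsFrom_eq_add_one_iff.2 (by omega), hk]⟩
  have hdown : ∀ m, ∀ v : Fin (n + 3), (v - a).val = j.val + m →
      ∃ k, (arcsFrom a j)^[k] v = p := by
    intro m
    induction m with
    | zero => exact fun v hv => hup 0 v hv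
    | succ m ih =>
      intro v hv
      have hva : v ≠ a := by
        rintro rfl
        simp at hv
      obtain ⟨k, hk⟩ := ih (v - 1) (by rw [val_sub_one_sub hva]; omega)
      exact ⟨k + 1, by
        rw [Function.iterate_succ_apply, arcsFrom_eq_sub_one_iff.2 (by omega), hk]⟩
  rcases le_total (v - a).val j.val with h | h
  · exact hup (j.val - (v - a).val) v (by omega)
  · exact hdown ((v - a).val - j.val) v (by omega)

theorem le_ncard_edgeVarPairs_cycleGraph :
    2 * (n + 3) * (n + 2) ≤ (edgeVarPairs O).ncard := by
  let p : Fin (n + 3) → Fin (n + 2) → Fin (n + 3) := fun a j => a + j.castSucc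
  have hp : ∀ a j, (p a j - a).val = j.val := fun a j => by simp [p]
  let f : Fin (n + 3) × Fin (n + 2) × Bool →
      Assignment (SimpleGraph.cycleGraph (n + 3)) × Fin (n + 3) := fun q =>
    (ofHeads _ (adj_arcsFrom q.1 q.2.1), if q.2.2 then p q.1 q.2.1 else p q.1 q.2.1 + 1)
  have hinj : Function.Injective f := by
    rintro ⟨a, j, b⟩ ⟨a', j', b'⟩ h
    have h1 : arcsFrom a j = arcsFrom a' j' := congrArg heads (congrArg Prod.fst h)
    have h2 : (if b then p a j else p a j + 1) = if b' then p a' j' else p a' j' + 1 :=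
      congrArg Prod.snd h
    obtain rfl : a = a' := by
      rw [← arcsFrom_valley_iff (j := j'), ← h1, arcsFrom_valley_iff]
    obtain rfl : j = j' := by
      have h3 := arcsFrom_peak_iff.2 (hp a j)
      rw [h1, arcsFrom_peak_iff, hp] at h3
      exact Fin.ext h3
    have : b = b' := by
      cases b <;> cases b' <;> simp at h2 ⊢
    rw [this]
  have hmem : Set.range f ⊆ edgeVarPairs O := by
    rintro _ ⟨⟨a, j, b⟩, rfl⟩
    obtain ⟨h1, h2⟩ := arcsFrom_peak_iff.2 (hp a j)
    let σ : Assignment (SimpleGraph.cycleGraph (n + 3)) := ofHeads _ (adj_arcsFrom a j)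
    let e : (SimpleGraph.cycleGraph (n + 3)).edgeSet :=
      ⟨s(p a j, p a j + 1), cycleGraph_adj_iff.2 (Or.inl rfl)⟩
    have he : σ ∈ badEvent O (.inl e) := by
      intro u v huv
      rcases Sym2.eq_iff.1 huv with ⟨rfl, rfl⟩ | ⟨rfl, rfl⟩
      · exact h1
      · exact h2
    have hpe : p a j ∈ badVars O (.inl e) := Sym2.mem_mk_left _ _
    refine ⟨e, ⟨he, fun i hi hiσ => hi ?_⟩, ?_⟩
    · -- any other cycle of `σ` would have to pass through the peak
      obtain ⟨v, hv, -⟩ := isCycle_eventPerm O i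
      obtain ⟨k, hk⟩ := exists_iterate_arcsFrom (hp a j) v
      have h3 := (((mem_badEvent O).1 hiσ).iterate hv k).2
      change eventPerm O i ((arcsFrom a j)^[k] v) ≠ (arcsFrom a j)^[k] v at h3
      rw [hk] at h3
      exact badEvent_eq_of_mem O hiσ he ((mem_badVars O).2 h3) hpe
    · change (if b then p a j else p a j + 1) ∈ s(p a j, p a j + 1)
      cases b <;> simp
  have h1 := Set.ncard_le_ncard hmem (Set.toFinite _)
  rw [← Set.image_univ, Set.ncard_image_of_injective _ hinj, Set.ncard_univ,
    Nat.card_eq_fintype_card] at h1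
  simp only [Fintype.card_prod, Fintype.card_fin, Fintype.card_bool] at h1
  linarith

theorem expectedResampled_cycleGraph :
    expectedResampled O =
      ENNReal.ofReal (2 * ((n + 3 : ℕ) : ℝ) ^ 2 - ((n + 3 : ℕ) : ℝ)) := by
  have hG : (SimpleGraph.cycleGraph (n + 3)).Connected := SimpleGraph.cycleGraph_connected
  have hm := card_le_ncard_edgeSet_cycleGraph (n := n)
  have hne := noBad_nonempty O hG hm
  have h0 : (noBad O).ncard = 1 :=
    le_antisymm (ncard_noBad_cycleGraph_le O) ((Set.ncard_pos (Set.toFinite _)).2 hne)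
  have hE : (edgeVarPairs O).ncard = 2 * (n + 3) * (n + 2) := by
    refine le_antisymm ?_ (le_ncard_edgeVarPairs_cycleGraph O)
    have := ncard_edgeVarPairs_le O hG hm
    rwa [h0, Fintype.card_fin, mul_one] at this
  have hC : (cycleVarPairs O).ncard = n + 3 := by
    refine le_antisymm ?_ (le_ncard_cycleVarPairs_cycleGraph O)
    have := ncard_cycleVarPairs_le O
    rwa [h0, Fintype.card_fin, mul_one] at this
  rw [expectedResampled_eq O hne, h0, hE, hC, Nat.cast_one, div_one, div_one, ← Nat.cast_add,
    ← ENNReal.ofReal_natCast]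
  congr 1
  push_cast
  ring

end CycleGraph

end BicyclePopping

end

open BicyclePopping in
theorem theorem2 :
    (∀ {V : Type*} [Fintype V] (G : SimpleGraph V), G.Connected →
      Fintype.card V ≤ G.edgeSet.ncard → ∀ O : CycleOrientation G,
        expectedResampled O ≤
            ENNReal.ofReal (2 * (Fintype.card V : ℝ) ^ 2 - (Fintype.card V : ℝ)) ∧
        0 < (noBad O).ncard ∧
        expectedResampled O =
            ((edgeVarPairs O).ncard : ℝ≥0∞) / ((noBad O).ncard : ℝ≥0∞) +
              ((cycleVarPairs O).ncard : ℝ≥0∞) / ((noBad O).ncard : ℝ≥0∞) ∧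
        (edgeVarPairs O).ncard ≤
            2 * Fintype.card V * (Fintype.card V - 1) * (noBad O).ncard ∧
        (cycleVarPairs O).ncard ≤ Fintype.card V * (noBad O).ncard) ∧
    (∀ n : ℕ, 3 ≤ n → ∀ O : CycleOrientation (SimpleGraph.cycleGraph n),
        expectedResampled O = ENNReal.ofReal (2 * (n : ℝ) ^ 2 - (n : ℝ))) := by
  refine ⟨fun G hG hm O => ?_, fun n hn O => ?_⟩
  · have hne := noBad_nonempty O hG hm
    exact ⟨expectedResampled_le O hG hm, (Set.ncard_pos (Set.toFinite _)).2 hne,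
      expectedResampled_eq O hne, ncard_edgeVarPairs_le O hG hm, ncard_cycleVarPairs_le O⟩
  · obtain ⟨k, rfl⟩ := Nat.exists_eq_add_of_le' hn
    exact expectedResampled_cycleGraph O
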